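/- Let $\mathcal X\subseteq\mathbb R^d$, $c\in\mathbb R^d$, let $\mathcal Y$ be a measurable space, and for $\xi\in\mathcal Y$ let $\mathcal X_\xi\subseteq\mathcal X$ be convex, with $\{\xi: x\in\mathcal X_\xi\}$ measurable for every $x$. For a probability measure $\mathbb P$ on $\mathcal Y$ and $\epsilon>0$ consider the chance-constrained program $$\min_{x\in\mathcal X} c^Tx\quad\text{s.t.}\quad \mathbb P(x\in\mathcal X_\xi)\ge 1-\epsilon .\qquad (\mathrm{CCP})$$ Assume that for every $m\ge 1$ and all $\xi_1,\dots,\xi_m\in\mathcal Y$ the scenario program $\min\{c^Tx : x\in\mathcal X,\ x\in\mathcal X_{\xi_i},\ i=1,\dots,m\}$ has a feasible region with nonempty interior and a unique optimal solution. For $\delta,\beta>0$ put $N_{exact}(\delta,\beta,d)=\min\{n\geq 0:\sum_{i=0}^{d-1}\binom ni\delta^i(1-\delta)^{n-i}\le\beta\}$, and for a probability measure $\mathbb P_0$ and a set $\mathcal U$ of probability measures on $\mathcal Y$ put $$M(\mathbb P_0,\mathcal U,\delta)=\sup\{\mathbb Q(A):\mathbb Q\in\mathcal U,\ A\subseteq\mathcal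 Y\text{ measurable},\ \mathbb P_0(A)\le\delta\}\qquad(\sup\emptyset=0).$$ For each $n$ let $\xi_1,\dots,\xi_n$ be i.i.d. data from $\mathbb P$, with joint law $\mathbb P_{data}$, and let the set $\mathcal U_{data}$ of probability measures, the probability measure $\mathbb P_0$ (the generating distribution) and $\delta_\epsilon>0$ be determined (measurably) by the data, such that $M(\mathbb P_0,\mathcal U_{data},\delta_\epsilon)\le\epsilon$ almost surely. Conditionally on the data, draw $N=N_{exact}(\delta_\epsilon,\beta,d)$ i.i.d. Monte Carlo samples $\xi^{MC}_1,\dots,\xi^{MC}_N$ from $\mathbb P_0$, and let $\hat x^{MC}$ be the optimal solution of the scenario program with these scenarios. Let $\alpha\in\mathbb R$, $\beta>0$. If $$\liminf_{n\to\infty}\mathbb P_{data}(\mathbb P\in\mathcal U_{data})\ge 1-\alpha,$$ then $$\liminf_{n\to\infty}\Pr\big(\hat x^{MC}\text{ is feasible for (CCP)}\big)\ge 1-\alpha-\beta,$$ where $\Pr$ is the joint law of the data and the Monte Carlo samples. (If $N=0$, which is possible only if $\beta\ge1$ or $d=0$, $\hat x^{MC}$ may be any point of $\mathbb R^d$.)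 -/

import Mathlib

open MeasureTheory ProbabilityTheory Filter
open scoped ENNReal

/-- The data of a chance-constrained program over `ℝ^d`: minimize `⟪c, x⟫` over `x ∈ X` subject to
`x ∈ safe ξ` with high probability, where `safe ξ ⊆ X` depends on the random outcome `ξ : 𝒴`. -/
structure ChanceProgram (d : ℕ) (𝒴 : Type*) where
  /-- the deterministic decision domain -/
  X : Set (EuclideanSpace ℝ (Fin d))
  /-- the cost vector -/
  c : EuclideanSpace ℝ (Fin d)
  /-- the set of decisions that are safe under the outcome `ξ` -/
  safe : 𝒴 → Set (EuclideanSpace ℝ (Fin d))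
  safe_subset : ∀ ξ, safe ξ ⊆ X

namespace ChanceProgram

variable {d : ℕ} {𝒴 : Type*}

/-- Feasible region of the scenario program built from the scenarios `ξ 0, …, ξ (m - 1)`. -/
def scenarioRegion (C : ChanceProgram d 𝒴) {m : ℕ} (ξ : Fin m → 𝒴) :
    Set (EuclideanSpace ℝ (Fin d)) :=
  {x | x ∈ C.X ∧ ∀ i, x ∈ C.safe (ξ i)}

/-- `x` is an optimal solution of the scenario program built from `ξ`. -/
def IsScenarioSolution (C : ChanceProgram d 𝒴) {m : ℕ} (ξ : Fin m → 𝒴)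
    (x : EuclideanSpace ℝ (Fin d)) : Prop :=
  x ∈ C.scenarioRegion ξ ∧ ∀ y ∈ C.scenarioRegion ξ, inner ℝ C.c x ≤ inner ℝ C.c y

/-- `x` is feasible for the chance-constrained program with outcome law `P` and tolerance `ε`. -/
def IsFeasible [MeasurableSpace 𝒴] (C : ChanceProgram d 𝒴) (P : Measure 𝒴) (ε : ℝ)
    (x : EuclideanSpace ℝ (Fin d)) : Prop :=
  x ∈ C.X ∧ 1 - ε ≤ P.real {ξ | x ∈ C.safe ξ}

end ChanceProgram

/-- The sample size requirement
`N_exact(ε, β, d) = min {n : ∑_{i=0}^{d-1} (n choose i) ε^i (1-ε)^(n-i) ≤ β}`. -/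
noncomputable def exactSampleSize (ε β : ℝ) (d : ℕ) : ℕ :=
  sInf {n : ℕ | ∑ i ∈ Finset.range d, (n.choose i : ℝ) * ε ^ i * (1 - ε) ^ (n - i) ≤ β}

/-- The bounding function `M(P₀, U, δ)`: the supremum of `Q(A)` over `Q ∈ U` and over the events `A`
with `P₀(A) ≤ δ`. -/
noncomputable def boundingFunction {𝒴 : Type*} [MeasurableSpace 𝒴] (P₀ : Measure 𝒴)
    (U : Set (ProbabilityMeasure 𝒴)) (δ : ℝ) : ℝ≥0∞ :=
  ⨆ (Q ∈ U) (A : Set 𝒴) (_ : MeasurableSet A) (_ : P₀ A ≤ ENNReal.ofReal δ), (Q : Measure 𝒴) A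

/-- The law of `n` i.i.d. data points drawn from `P`. -/
noncomputable def dataLaw {𝒴 : Type*} [MeasurableSpace 𝒴] (P : ProbabilityMeasure 𝒴) (n : ℕ) :
    Measure (Fin n → 𝒴) :=
  Measure.pi fun _ => (P : Measure 𝒴)

/-- The probability, under the joint law of data and Monte Carlo samples, that the Monte Carlo
samples fall in the event `S`. The data `D` consist of `n` i.i.d. draws from `P`; conditionally on
`D`, there are `N D` Monte Carlo samples, drawn i.i.d. from the generating distribution `P₀ D`.
The event `S m` is the set of the favourable Monte Carlo samples of size `m`. -/
noncomputable def jointConfidence {𝒴 : Type*} [MeasurableSpace 𝒴] (P : ProbabilityMeasure 𝒴)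
    {n : ℕ} (P₀ : Kernel (Fin n → 𝒴) 𝒴) (N : (Fin n → 𝒴) → ℕ)
    (S : ∀ m : ℕ, Set (Fin m → 𝒴)) : ℝ≥0∞ :=
  ∫⁻ D, Measure.pi (fun _ : Fin (N D) => P₀ D) (S (N D)) ∂(dataLaw P n)

/-!
The theorem reduces to the exact feasibility bound for convex scenario programs: the solution of a
program with `N` scenarios drawn from `Q` has violation probability above `δ` with probability at
most `∑ i < d, (N choose i) δ ^ i (1 - δ) ^ (N - i)` (`ChanceProgram.measureReal_violation_le`).
With `Q` the generating distribution and `N` the required sample size, the solution fails, with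
conditional probability at least `1 - β`, only on an event of `Q`-measure at most `δ`; if the true
distribution lies in the uncertainty set, the bounding function turns this into a true failure
probability of at most `ε`. Averaging over the data loses only the event that the uncertainty set
misses the true distribution.

The feasibility bound is a counting statement about finitely many convex sets. For `N + m` fixed
scenarios, consider the `N`-subsets whose solution violates `k` or more of the others. By
exchangeability (`choose_mul_measure_le_of_card_le`) a bound on their number bounds a probability,
by Chebyshev's inequality the fraction of the `m` further scenarios that are violated is close to
the violation probability, and as `m → ∞` the hypergeometric count becomes a binomial tail.

The count (`card_filter_violated_le`) is first carried out for a nondegenerate problem of LP type of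
combinatorial dimension `d`. There each `R` has a canonical `d`-subset `B` that determines its
optimal value, and `B` represents exactly the sets between `B` and the union of `B` with its
harmless constraints. Counting `N`-sets by their representatives, for all `N`, gives all binomial
moments of the numbers of harmless constraints; these determine their distribution, which is
therefore the same as for the problem of finding the `d`-th largest of distinct numbers. The given
convex sets may be degenerate and need not be closed. Since only the finitely many solutions of
subproblems matter, each set may be replaced by the polytope spanned by the solutions it contains.
Thickening the polytopes by small generic amounts and adding a small multiple of `‖x‖ ^ 2` to the
objective gives unique minimizers, Helly's theorem gives dimension `d`, genericity excludes
degeneracy (`exists_relaxation_isNondegenerateLPType`), and smallness guarantees that optimal values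
which differ remain ordered the same way, so that no violation is lost.

The solution need not depend measurably on the scenarios. The violation event is measurable
nevertheless, because a scenario is violated exactly when adding it raises the optimal value
(`ChanceProgram.measurableSet_violation`).
-/

/-! ### Binomial identities -/

/-- The number of `N`-subsets of an `n`-set which meet a given `q`-subset in fewer than `d` points:
the unnormalized hypergeometric distribution function. -/
def hypergeomCount (n N d q : ℕ) : ℕ :=
  ∑ i ∈ Finset.range d, q.choose i * (n - q).choose (N - i)

theorem hypergeomCount_eq_succ_add (e r n q : ℕ) (hq : q < n) :
    hypergeomCount n (r + e + 1) (e + 1) q =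
      hypergeomCount n (r + e + 1) (e + 1) (q + 1) + q.choose e * (n - 1 - q).choose r := by
  obtain ⟨a, rfl⟩ : ∃ a, n = q + a + 1 := ⟨n - q - 1, by omega⟩
  have h1 : q + a + 1 - q = a + 1 := by omega
  have h2 : q + a + 1 - (q + 1) = a := by omega
  have h3 : q + a + 1 - 1 - q = a := by omega
  simp only [hypergeomCount, h1, h2, h3]
  induction e generalizing r with
  | zero => simp [Nat.choose_succ_succ, add_comm]
  | succ e ih =>
    have := ih (r + 1)
    rw [show r + 1 + e + 1 = r + (e + 1) + 1 by omega] at this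
    rw [Finset.sum_range_succ, this, Finset.sum_range_succ _ (e + 1),
      show r + (e + 1) + 1 - (e + 1) = r + 1 by omega, Nat.choose_succ_succ a r,
      Nat.choose_succ_succ q e]
    ring

theorem hypergeomCount_eq_sum_Ico (e r n q : ℕ) (hq : q ≤ n) :
    hypergeomCount n (r + e + 1) (e + 1) q =
      ∑ j ∈ Finset.Ico q n, j.choose e * (n - 1 - j).choose r := by
  induction hq using Nat.decreasingInduction with
  | self =>
    simp only [Finset.Ico_self, Finset.sum_empty, hypergeomCount]
    refine Finset.sum_eq_zero fun i hi => ?_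
    have : i < e + 1 := Finset.mem_range.1 hi
    rw [Nat.choose_eq_zero_of_lt (show n - n < r + e + 1 - i by omega), mul_zero]
  | of_succ q hq ih =>
    rw [hypergeomCount_eq_succ_add e r n q hq, ih, Finset.sum_eq_sum_Ico_succ_bot hq, add_comm]

theorem sum_choose_mul_choose_sub (e r n : ℕ) :
    ∑ s ∈ Finset.range n, (n - 1 - s).choose e * s.choose r = n.choose (r + e + 1) := by
  have h0 : hypergeomCount n (r + e + 1) (e + 1) 0 = n.choose (r + e + 1) := by
    simp [hypergeomCount, Finset.sum_range_succ']
  rw [← h0, hypergeomCount_eq_sum_Ico e r n 0 (Nat.zero_le _), ← Finset.range_eq_Ico,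
    ← Finset.sum_range_reflect]
  refine Finset.sum_congr rfl fun j hj => ?_
  have := Finset.mem_range.1 hj
  rw [show n - 1 - (n - 1 - j) = j by omega]

/-- A finitely supported sequence is determined by its binomial moments. -/
theorem eq_of_sum_mul_choose_eq (f g : ℕ → ℕ) (M : ℕ)
    (h : ∀ r, ∑ s ∈ Finset.range M, f s * s.choose r = ∑ s ∈ Finset.range M, g s * s.choose r) :
    ∀ s < M, f s = g s := by
  induction M with
  | zero => simp
  | succ M ih =>
    have hM : f M = g M := by
      have := h M
      rw [Finset.sum_range_succ, Finset.sum_range_succ, Finset.sum_eq_zero, Finset.sum_eq_zero] at this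
      · simpa using this
      all_goals
        intro s hs
        rw [Nat.choose_eq_zero_of_lt (Finset.mem_range.1 hs), mul_zero]
    have ih' := ih fun r => by
      have := h r
      rw [Finset.sum_range_succ, Finset.sum_range_succ, hM] at this
      exact Nat.add_right_cancel this
    intro s hs
    rcases Nat.lt_succ_iff_lt_or_eq.1 hs with h' | rfl
    · exact ih' s h'
    · exact hM

/-- If the binomial moments of a finite family of numbers `s b` are those of the minima of the
`(e + 1)`-subsets of `{0, …, n - 1}`, then so are its truncated binomial moments. -/
theorem sum_choose_filter_eq_hypergeomCount {ι : Type*} (B : Finset ι) (s : ι → ℕ) (n e : ℕ)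
    (h : ∀ r, ∑ b ∈ B, (s b).choose r = n.choose (r + e + 1)) (r q : ℕ) (hq : q ≤ n) :
    ∑ b ∈ B with s b + q < n, (s b).choose r = hypergeomCount n (r + e + 1) (e + 1) q := by
  classical
  obtain ⟨M, hMn, hM⟩ : ∃ M, n ≤ M ∧ ∀ b ∈ B, s b < M :=
    ⟨n + B.sup s + 1, by omega, fun b hb => by
      have := Finset.le_sup (f := s) hb
      omega⟩
  have key : ∀ (p : ℕ → Prop) [DecidablePred p] (r : ℕ), ∑ b ∈ B with p (s b), (s b).choose r =
      ∑ j ∈ Finset.range M, (if p j then (B.filter fun b => s b = j).card * j.choose r else 0) := by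
    intro p _ r
    rw [← Finset.sum_fiberwise_of_maps_to (t := Finset.range M) (g := s)]
    · refine Finset.sum_congr rfl fun j _ => ?_
      rw [Finset.filter_filter]
      split_ifs with hp
      · rw [Finset.sum_congr (g := fun _ => j.choose r) rfl, Finset.sum_const, smul_eq_mul]
        · congr 2
          ext b
          simp only [Finset.mem_filter]
          constructor
          · rintro ⟨a, b, c⟩
            exact ⟨a, c⟩
          · rintro ⟨a, rfl⟩
            exact ⟨a, hp, rfl⟩
        · intro b hb
          rw [(Finset.mem_filter.1 hb).2.2]
      · refine Finset.sum_eq_zero fun b hb => ?_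
        obtain ⟨-, h1, h2⟩ := Finset.mem_filter.1 hb
        exact absurd (h2 ▸ h1) hp
    · intro b hb
      exact Finset.mem_range.2 (hM b (Finset.mem_filter.1 hb).1)
  have hcount : ∀ j < M, (B.filter fun b => s b = j).card =
      if j < n then (n - 1 - j).choose e else 0 := by
    refine eq_of_sum_mul_choose_eq _ _ M fun r => ?_
    have h1 := key (fun _ => True) r
    simp only [if_true, Finset.filter_true] at h1
    rw [← h1, h r, ← sum_choose_mul_choose_sub]
    simp only [ite_mul, zero_mul]
    rw [← Finset.sum_filter]
    refine Finset.sum_congr ?_ fun _ _ => rfl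
    ext j
    simp only [Finset.mem_range, Finset.mem_filter]
    omega
  have h2 := key (fun j => j + q < n) r
  rw [h2, hypergeomCount_eq_sum_Ico e r n q hq]
  have h3 : ∀ j ∈ Finset.range M,
      (if j + q < n then (B.filter fun b => s b = j).card * j.choose r else 0) =
      if j + q < n then (n - 1 - j).choose e * j.choose r else 0 := by
    intro j hj
    split_ifs with h4
    · rw [hcount j (Finset.mem_range.1 hj), if_pos (by omega)]
    · rfl
  rw [Finset.sum_congr rfl h3, ← Finset.sum_filter]
  refine Finset.sum_bij' (fun j _ => n - 1 - j) (fun j _ => n - 1 - j) ?_ ?_ ?_ ?_ ?_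
  all_goals
    intro j hj
    simp only [Finset.mem_Ico, Finset.mem_filter, Finset.mem_range] at hj ⊢
  any_goals omega
  rw [show n - 1 - (n - 1 - j) = j by omega]

/-! ### Nondegenerate optimization problems of LP type -/

section LPType

variable {H : Type*} [Fintype H] [LinearOrder H]

/-- The support constraints of `R`: those whose removal lowers the optimal value `w R`. -/
noncomputable def supportSet (w : Finset H → ℝ) (R : Finset H) : Finset H :=
  R.filter fun h => w (R.erase h) < w R

/-- `w` assigns to each finite set of constraints the optimal value of an LP-type problem of
combinatorial dimension at most `d`, which is nondegenerate: the support constraints alone determine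
the optimal value. -/
structure IsNondegenerateLPType (w : Finset H → ℝ) (d : ℕ) : Prop where
  mono : Monotone w
  locality : ∀ F G, F ⊆ G → w F = w G → ∀ h, w (insert h F) = w F → w (insert h G) = w G
  value_supportSet : ∀ R, w (supportSet w R) = w R
  card_supportSet_le : ∀ R, (supportSet w R).card ≤ d

omit [Fintype H] in
theorem supportSet_subset (w : Finset H → ℝ) (R : Finset H) : supportSet w R ⊆ R :=
  Finset.filter_subset _ _

/-- The constraints which may be added to `B` without changing the set that represents it: `B`
consists of its support constraints and of fillers, so a harmless constraint must keep the optimal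
value and must have lower priority (be smaller) than every filler. -/
noncomputable def harmless (w : Finset H → ℝ) (B : Finset H) : Finset H :=
  Finset.univ.filter fun h => h ∉ B ∧ w (insert h B) = w B ∧ ∀ b ∈ B \ supportSet w B, h < b

omit [Fintype H] in
/-- Every finite set has a unique upper segment of given size; this is the existence part. -/
theorem exists_upper_subset_card_eq (S : Finset H) (j : ℕ) (hj : j ≤ S.card) :
    ∃ T ⊆ S, T.card = j ∧ ∀ t ∈ T, ∀ s ∈ S \ T, s < t := by
  induction j with
  | zero => exact ⟨∅, by simp⟩
  | succ j ih =>
    obtain ⟨T, hTS, hT, h⟩ := ih (by omega)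
    have hne : (S \ T).Nonempty := by
      rw [← Finset.card_pos, Finset.card_sdiff_of_subset hTS]
      omega
    have hm := Finset.max'_mem _ hne
    set m := (S \ T).max' hne
    have hm' := Finset.mem_sdiff.1 hm
    refine ⟨insert m T, Finset.insert_subset hm'.1 hTS, by
      rw [Finset.card_insert_of_notMem hm'.2, hT], ?_⟩
    intro t ht s hs
    have hs' : s ∈ S \ T := by
      simp only [Finset.mem_sdiff, Finset.mem_insert, not_or] at hs ⊢
      exact ⟨hs.1, hs.2.2⟩
    rcases Finset.mem_insert.1 ht with rfl | ht
    · refine lt_of_le_of_ne (Finset.le_max' _ _ hs') ?_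
      rintro rfl
      simp at hs
    · exact h t ht s hs'

omit [Fintype H] in
theorem upper_subset_unique (S T T' : Finset H) (hT : T ⊆ S) (hT' : T' ⊆ S)
    (hc : T.card = T'.card) (h : ∀ t ∈ T, ∀ s ∈ S \ T, s < t)
    (h' : ∀ t ∈ T', ∀ s ∈ S \ T', s < t) : T = T' := by
  by_contra hne
  have h1 : ¬ T ⊆ T' := fun hs => hne (Finset.eq_of_subset_of_card_le hs hc.ge)
  have h2 : ¬ T' ⊆ T := fun hs => hne (Finset.eq_of_subset_of_card_le hs hc.le).symm
  obtain ⟨t, ht, ht'⟩ := Finset.not_subset.1 h1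
  obtain ⟨u, hu, hu'⟩ := Finset.not_subset.1 h2
  exact lt_asymm (h t ht u (by simp [hT' hu, hu'])) (h' u hu t (by simp [hT ht, ht']))

namespace IsNondegenerateLPType

variable {w : Finset H → ℝ} {d : ℕ}

omit [Fintype H] in
/-- Discarding constraints outside the support does not change the support. -/
theorem supportSet_eq_of_subset (hw : IsNondegenerateLPType w d) {B R : Finset H} (hBR : B ⊆ R)
    (hB : supportSet w R ⊆ B) : supportSet w B = supportSet w R := by
  have hwB : w B = w R := le_antisymm (hw.mono hBR) (hw.value_supportSet R ▸ hw.mono hB)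
  ext h
  constructor
  · intro hh
    by_contra hn
    have h1 : supportSet w R ⊆ B.erase h := fun x hx =>
      Finset.mem_erase.2 ⟨fun e => hn (e ▸ hx), hB hx⟩
    have h2 := hw.mono h1
    rw [hw.value_supportSet] at h2
    exact absurd (Finset.mem_filter.1 hh).2 (not_lt.2 (hwB ▸ h2))
  · intro hh
    refine Finset.mem_filter.2 ⟨hB hh, ?_⟩
    rw [hwB]
    exact (hw.mono (Finset.erase_subset_erase h hBR)).trans_lt (Finset.mem_filter.1 hh).2

omit [Fintype H] in
/-- By locality, constraints that do not raise the value of `B` one at a time do not raise it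
together. -/
theorem value_union_eq (hw : IsNondegenerateLPType w d) (B T : Finset H)
    (h : ∀ t ∈ T, w (insert t B) = w B) : w (B ∪ T) = w B := by
  induction T using Finset.induction_on with
  | empty => simp
  | insert t T _ ih =>
    have ih' := ih fun s hs => h s (Finset.mem_insert_of_mem hs)
    rw [Finset.union_insert, hw.locality B (B ∪ T) Finset.subset_union_left ih'.symm t
      (h t (Finset.mem_insert_self _ _)), ih']

/-- The two descriptions of the relation that `B` represents `R`: all other elements of `R` are
harmless for `B`; or, `B` consists of the support constraints of `R` and of the largest among the
other elements of `R`. -/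
theorem subset_harmless_iff (hw : IsNondegenerateLPType w d) {B R : Finset H} (hBR : B ⊆ R) :
    R \ B ⊆ harmless w B ↔
      supportSet w R ⊆ B ∧ ∀ b ∈ B \ supportSet w R, ∀ s ∈ R \ B, s < b := by
  constructor
  · intro h
    have hwR : w R = w B := by
      have := hw.value_union_eq B (R \ B) fun t ht => (Finset.mem_filter.1 (h ht)).2.2.1
      rwa [Finset.union_sdiff_of_subset hBR] at this
    have hs : supportSet w R ⊆ B := by
      intro x hx
      by_contra hxB
      have h1 : B ⊆ R.erase x := fun y hy =>
        Finset.mem_erase.2 ⟨fun e => hxB (e ▸ hy), hBR hy⟩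
      have h2 := (Finset.mem_filter.1 hx).2
      exact absurd (hw.mono h1) (not_le.2 (hwR ▸ h2))
    refine ⟨hs, fun b hb s hsR => ?_⟩
    rw [← hw.supportSet_eq_of_subset hBR hs] at hb
    exact (Finset.mem_filter.1 (h hsR)).2.2.2 b hb
  · rintro ⟨hs, hb⟩ x hx
    have hx' := Finset.mem_sdiff.1 hx
    have hwB : w B = w R := le_antisymm (hw.mono hBR) (hw.value_supportSet R ▸ hw.mono hs)
    refine Finset.mem_filter.2 ⟨Finset.mem_univ _, hx'.2, le_antisymm ?_
      (hw.mono (Finset.subset_insert _ _)), fun b hb' => ?_⟩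
    · rw [hwB]
      exact hw.mono (Finset.insert_subset hx'.1 hBR)
    · rw [hw.supportSet_eq_of_subset hBR hs] at hb'
      exact hb b hb' x hx

/-- The representative of `R` is the set of its support constraints, filled up to size `d` with the
largest other elements of `R`. -/
theorem existsUnique_representative (hw : IsNondegenerateLPType w d) {R : Finset H}
    (hR : d ≤ R.card) : ∃! B, B ⊆ R ∧ B.card = d ∧ R \ B ⊆ harmless w B := by
  have hsR := supportSet_subset w R
  have hcard := hw.card_supportSet_le R
  obtain ⟨T, hT, hTc, hTu⟩ := exists_upper_subset_card_eq (R \ supportSet w R)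
    (d - (supportSet w R).card) (by rw [Finset.card_sdiff_of_subset hsR]; omega)
  have hdisj : Disjoint (supportSet w R) T :=
    Finset.disjoint_of_subset_right hT Finset.disjoint_sdiff
  refine ⟨supportSet w R ∪ T, ⟨Finset.union_subset hsR (hT.trans Finset.sdiff_subset), ?_, ?_⟩, ?_⟩
  · rw [Finset.card_union_of_disjoint hdisj]
    omega
  · rw [hw.subset_harmless_iff (Finset.union_subset hsR (hT.trans Finset.sdiff_subset))]
    refine ⟨Finset.subset_union_left, fun b hb s hs => ?_⟩
    simp only [Finset.mem_sdiff, Finset.mem_union, not_or] at hb hs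
    exact hTu b (hb.1.resolve_left hb.2) s (by simp [hs.1, hs.2.1, hs.2.2])
  · rintro B ⟨hBR, hBc, hB⟩
    rw [hw.subset_harmless_iff hBR] at hB
    obtain ⟨hsB, hBu⟩ := hB
    have : B \ supportSet w R = T := by
      refine upper_subset_unique (R \ supportSet w R) _ _ (Finset.sdiff_subset_sdiff hBR le_rfl) hT
        ?_ (fun t ht s hs => ?_) hTu
      · rw [Finset.card_sdiff_of_subset hsB, hTc, hBc]
      · refine hBu t ht s ?_
        simp only [Finset.mem_sdiff, not_and, not_not] at hs ⊢
        exact ⟨hs.1.1, fun h => hs.1.2 (hs.2 h)⟩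
    rw [← this, Finset.union_sdiff_of_subset hsB]

/-- The sets represented by `B` are those between `B` and `B ∪ harmless w B`. -/
theorem card_filter_representative (B : Finset H) (r : ℕ) :
    ((Finset.powersetCard (r + B.card) Finset.univ).filter
      fun R => B ⊆ R ∧ R \ B ⊆ harmless w B).card = (harmless w B).card.choose r := by
  have hd : Disjoint B (harmless w B) := by
    rw [Finset.disjoint_left]
    intro x hx hx'
    exact (Finset.mem_filter.1 hx').2.1 hx
  rw [← Finset.card_powersetCard]
  refine Finset.card_bij' (fun R _ => R \ B) (fun T _ => B ∪ T) ?_ ?_ ?_ ?_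
  · intro R hR
    simp only [Finset.mem_filter, Finset.mem_powersetCard, Finset.subset_univ, true_and] at hR ⊢
    exact ⟨hR.2.2, by rw [Finset.card_sdiff_of_subset hR.2.1]; omega⟩
  · intro T hT
    simp only [Finset.mem_filter, Finset.mem_powersetCard, Finset.subset_univ, true_and] at hT ⊢
    have hdT := Finset.disjoint_of_subset_right hT.1 hd
    refine ⟨by rw [Finset.card_union_of_disjoint hdT]; omega, Finset.subset_union_left, ?_⟩
    rw [Finset.union_sdiff_cancel_left hdT]
    exact hT.1
  · intro R hR
    exact Finset.union_sdiff_of_subset (Finset.mem_filter.1 hR).2.1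
  · intro T hT
    exact Finset.union_sdiff_cancel_left
      (Finset.disjoint_of_subset_right (Finset.mem_powersetCard.1 hT).1 hd)

/-- Each set with at least `d` elements has exactly one representative of size `d`; counting sets by
their representatives gives all binomial moments of the numbers of harmless constraints. -/
theorem sum_choose_card_harmless (hw : IsNondegenerateLPType w d) (r : ℕ) :
    ∑ B ∈ Finset.powersetCard d (Finset.univ : Finset H), (harmless w B).card.choose r =
      (Fintype.card H).choose (r + d) := by
  have h1 : ∀ B ∈ Finset.powersetCard d (Finset.univ : Finset H),
      (harmless w B).card.choose r = ((Finset.powersetCard (r + d) Finset.univ).filter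
        fun R => B ⊆ R ∧ R \ B ⊆ harmless w B).card := by
    intro B hB
    rw [← card_filter_representative B r, (Finset.mem_powersetCard.1 hB).2]
  rw [Finset.sum_congr rfl h1, ← Finset.card_univ (α := H), ← Finset.card_powersetCard]
  simp only [Finset.card_filter]
  rw [Finset.sum_comm, Finset.card_eq_sum_ones]
  refine Finset.sum_congr rfl fun R hR => ?_
  rw [← Finset.card_filter, Finset.card_eq_one]
  obtain ⟨B, hB, hBu⟩ := hw.existsUnique_representative (R := R)
    (by rw [(Finset.mem_powersetCard.1 hR).2]; omega)
  refine ⟨B, ?_⟩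
  ext B'
  simp only [Finset.mem_filter, Finset.mem_powersetCard, Finset.subset_univ, true_and,
    Finset.mem_singleton]
  constructor
  · rintro ⟨h1, h2, h3⟩
    exact hBu B' ⟨h2, h1, h3⟩
  · rintro rfl
    exact ⟨hB.2.1, hB.1, hB.2.2⟩

/-- The number of sets of `r + e + 1` constraints whose representative has few harmless constraints,
hence many violators, is a hypergeometric count. -/
theorem card_filter_harmless_le (e : ℕ) (hw : IsNondegenerateLPType w (e + 1)) (r q : ℕ)
    (hq : q ≤ Fintype.card H) (bad : Finset H → Prop) [DecidablePred bad]
    (hbad : ∀ B R : Finset H, B ⊆ R → B.card = e + 1 → w B = w R → R \ B ⊆ harmless w B → bad R →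
      (harmless w B).card + q < Fintype.card H) :
    ((Finset.powersetCard (r + e + 1) (Finset.univ : Finset H)).filter bad).card ≤
      hypergeomCount (Fintype.card H) (r + e + 1) (e + 1) q := by
  rw [← sum_choose_filter_eq_hypergeomCount (Finset.powersetCard (e + 1) Finset.univ)
    (fun B => (harmless w B).card) (Fintype.card H) e (fun r => hw.sum_choose_card_harmless r) r q
    hq]
  have h1 : ∀ B ∈ (Finset.powersetCard (e + 1) (Finset.univ : Finset H)).filter
      (fun B => (harmless w B).card + q < Fintype.card H),
      (harmless w B).card.choose r = ((Finset.powersetCard (r + e + 1) Finset.univ).filter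
        fun R => B ⊆ R ∧ R \ B ⊆ harmless w B).card := by
    intro B hB
    rw [← card_filter_representative B r,
      (Finset.mem_powersetCard.1 (Finset.mem_filter.1 hB).1).2, add_assoc]
  rw [Finset.sum_congr rfl h1]
  refine le_trans (Finset.card_le_card ?_) Finset.card_biUnion_le
  intro R hR
  rw [Finset.mem_filter] at hR
  have hRc := (Finset.mem_powersetCard.1 hR.1).2
  obtain ⟨B, ⟨hBR, hBc, hB⟩, -⟩ := hw.existsUnique_representative (R := R) (by omega)
  have hwB : w B = w R := le_antisymm (hw.mono hBR)
    (hw.value_supportSet R ▸ hw.mono ((hw.subset_harmless_iff hBR).1 hB).1)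
  refine Finset.mem_biUnion.2 ⟨B, Finset.mem_filter.2 ⟨Finset.mem_powersetCard.2
    ⟨Finset.subset_univ _, hBc⟩, hbad B R hBR hBc hwB hB hR.2⟩, ?_⟩
  exact Finset.mem_filter.2 ⟨hR.1, hBR, hB⟩

end IsNondegenerateLPType

end LPType

/-! ### Finitely many convex constraints with relaxed right-hand sides -/

section Relaxation

variable {H E : Type*}

/-- The points of `K` that satisfy the constraints `g h x ≤ τ h` for `h ∈ R`. -/
def relaxedRegion (K : Set E) (g : H → E → ℝ) (τ : H → ℝ) (R : Finset H) : Set E :=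
  {x | x ∈ K ∧ ∀ h ∈ R, g h x ≤ τ h}

/-- The minimum of the objective `f` under the constraints `g h x ≤ τ h` for `h ∈ R`. -/
noncomputable def relaxedValue (K : Set E) (f : E → ℝ) (g : H → E → ℝ) (τ : H → ℝ)
    (R : Finset H) : ℝ :=
  sInf (f '' relaxedRegion K g τ R)

theorem relaxedRegion_anti (K : Set E) (g : H → E → ℝ) (τ : H → ℝ) {F G : Finset H} (h : F ⊆ G) :
    relaxedRegion K g τ G ⊆ relaxedRegion K g τ F :=
  fun _ hx => ⟨hx.1, fun i hi => hx.2 i (h hi)⟩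

variable [NormedAddCommGroup E] [NormedSpace ℝ E]

/-- The standing assumptions on a relaxed program: a strictly convex objective, a compact convex
domain, convex constraint functions, and a point that satisfies all constraints. -/
structure IsRelaxedProgram (K : Set E) (f : E → ℝ) (g : H → E → ℝ) (τ : H → ℝ) : Prop where
  isCompact : IsCompact K
  convex : Convex ℝ K
  continuous_obj : Continuous f
  strictConvex_obj : StrictConvexOn ℝ Set.univ f
  continuous_con : ∀ h, Continuous (g h)
  convex_con : ∀ h, ConvexOn ℝ Set.univ (g h)
  feasible : ∃ x ∈ K, ∀ h, g h x ≤ τ h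

namespace IsRelaxedProgram

variable {K : Set E} {f : E → ℝ} {g : H → E → ℝ} {τ : H → ℝ}

theorem convex_relaxedRegion (hP : IsRelaxedProgram K f g τ) (R : Finset H) :
    Convex ℝ (relaxedRegion K g τ R) := by
  intro x hx y hy a b ha hb hab
  refine ⟨hP.convex hx.1 hy.1 ha hb hab, fun h hh => ?_⟩
  exact ((hP.convex_con h).convex_le (τ h) ⟨trivial, hx.2 h hh⟩ ⟨trivial, hy.2 h hh⟩ ha hb hab).2

theorem exists_minimizer (hP : IsRelaxedProgram K f g τ) (R : Finset H) :
    ∃ x ∈ relaxedRegion K g τ R, f x = relaxedValue K f g τ R ∧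
      ∀ y ∈ relaxedRegion K g τ R, f x ≤ f y := by
  have hc : IsCompact (relaxedRegion K g τ R) := by
    have : relaxedRegion K g τ R = K ∩ ⋂ h ∈ R, {x | g h x ≤ τ h} := by
      ext x
      simp [relaxedRegion]
    rw [this]
    exact hP.isCompact.inter_right
      (isClosed_biInter fun h _ => isClosed_le (hP.continuous_con h) continuous_const)
  obtain ⟨x0, hx0K, hx0⟩ := hP.feasible
  obtain ⟨x, hx, hmin⟩ := hc.exists_isMinOn ⟨x0, hx0K, fun h _ => hx0 h⟩
    hP.continuous_obj.continuousOn
  refine ⟨x, hx, ?_, hmin⟩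
  refine (IsLeast.csInf_eq (a := f x) (s := f '' relaxedRegion K g τ R)
    ⟨⟨x, hx, rfl⟩, ?_⟩).symm
  rintro _ ⟨y, hy, rfl⟩
  exact hmin hy

theorem value_le (hP : IsRelaxedProgram K f g τ) {R : Finset H} {y : E}
    (hy : y ∈ relaxedRegion K g τ R) : relaxedValue K f g τ R ≤ f y := by
  obtain ⟨x, -, hxv, hx⟩ := hP.exists_minimizer R
  exact hxv ▸ hx y hy

theorem minimizer_unique (hP : IsRelaxedProgram K f g τ) {R : Finset H} {x y : E}
    (hx : x ∈ relaxedRegion K g τ R) (hxv : f x = relaxedValue K f g τ R)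
    (hy : y ∈ relaxedRegion K g τ R) (hyv : f y = relaxedValue K f g τ R) : x = y := by
  by_contra hne
  have h1 := hP.strictConvex_obj.2 (Set.mem_univ x) (Set.mem_univ y) hne
    (show (0 : ℝ) < 1 / 2 by norm_num) (show (0 : ℝ) < 1 / 2 by norm_num) (by norm_num)
  have h2 := hP.value_le (hP.convex_relaxedRegion R hx hy
    (show (0 : ℝ) ≤ 1 / 2 by norm_num) (show (0 : ℝ) ≤ 1 / 2 by norm_num) (by norm_num))
  rw [hxv, hyv] at h1
  simp only [smul_eq_mul] at h1
  linarith

theorem value_mono (hP : IsRelaxedProgram K f g τ) : Monotone (relaxedValue K f g τ) := by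
  intro F G hFG
  obtain ⟨x, hx, hxv, -⟩ := hP.exists_minimizer G
  exact hxv ▸ hP.value_le (relaxedRegion_anti K g τ hFG hx)

theorem locality [DecidableEq H] (hP : IsRelaxedProgram K f g τ) (F G : Finset H) (hFG : F ⊆ G)
    (hv : relaxedValue K f g τ F = relaxedValue K f g τ G) (h : H)
    (hh : relaxedValue K f g τ (insert h F) = relaxedValue K f g τ F) :
    relaxedValue K f g τ (insert h G) = relaxedValue K f g τ G := by
  obtain ⟨x, hx, hxv, -⟩ := hP.exists_minimizer G
  obtain ⟨y, hy, hyv, -⟩ := hP.exists_minimizer (insert h F)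
  have hxy : x = y := hP.minimizer_unique (relaxedRegion_anti K g τ hFG hx) (hxv.trans hv.symm)
    (relaxedRegion_anti K g τ (Finset.subset_insert h F) hy) (hyv.trans hh)
  refine le_antisymm ?_ (hP.value_mono (Finset.subset_insert h G))
  rw [← hxv]
  refine hP.value_le ⟨hx.1, fun i hi => ?_⟩
  rcases Finset.mem_insert.1 hi with rfl | hi
  · exact hxy ▸ hy.2 i (Finset.mem_insert_self _ _)
  · exact hx.2 i hi

/-- By Helly's theorem, at most `dim E` of the constraints determine the optimal value: otherwise the
sublevel set `{f < value}` would meet the intersection of all the constraints. -/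
theorem exists_subset_card_le_finrank [FiniteDimensional ℝ E]
    (hP : IsRelaxedProgram K f g τ) (G : Finset H) :
    ∃ F ⊆ G, F.card ≤ Module.finrank ℝ E ∧ relaxedValue K f g τ F = relaxedValue K f g τ G := by
  classical
  by_contra! hcon
  have hlt : ∀ F ⊆ G, F.card ≤ Module.finrank ℝ E →
      relaxedValue K f g τ F < relaxedValue K f g τ G := fun F hF hc =>
    lt_of_le_of_ne (hP.value_mono hF) (hcon F hF hc)
  let S : Option H → Set E := fun o => o.elim {x | x ∈ K ∧ f x < relaxedValue K f g τ G}
    fun h => relaxedRegion K g τ {h}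
  have hS := Convex.helly_theorem' (𝕜 := ℝ) (F := S) (s := Finset.insertNone G) ?_ ?_
  · obtain ⟨x, hx⟩ := hS
    simp only [Set.mem_iInter] at hx
    have h0 : x ∈ K ∧ f x < relaxedValue K f g τ G := hx none (by simp)
    have h1 : x ∈ relaxedRegion K g τ G := ⟨h0.1, fun h hh =>
      (hx (some h) (by simpa using hh) : x ∈ relaxedRegion K g τ {h}).2 h (by simp)⟩
    exact absurd (hP.value_le h1) (not_le.2 h0.2)
  · rintro (_ | h) -
    · intro x hx y hy a b ha hb hab
      exact ⟨hP.convex hx.1 hy.1 ha hb hab,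
        (hP.strictConvex_obj.convexOn.convex_lt _ ⟨trivial, hx.2⟩ ⟨trivial, hy.2⟩ ha hb hab).2⟩
    · exact hP.convex_relaxedRegion _
  · intro I hI hIc
    have hF : Finset.eraseNone I ⊆ G := by
      intro h hh
      simpa using hI (Finset.mem_eraseNone.1 hh)
    by_cases hn : none ∈ I
    · obtain ⟨x, hx, hxv, -⟩ := hP.exists_minimizer (Finset.eraseNone I)
      refine ⟨x, Set.mem_iInter₂.2 ?_⟩
      rintro (_ | h) hh
      · refine ⟨hx.1, hxv ▸ hlt _ hF ?_⟩
        rw [Finset.card_eraseNone_of_mem hn]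
        omega
      · refine ⟨hx.1, fun i hi => ?_⟩
        rw [Finset.mem_singleton.1 hi]
        exact hx.2 h (Finset.mem_eraseNone.2 hh)
    · obtain ⟨x, hx, -⟩ := hP.exists_minimizer G
      refine ⟨x, Set.mem_iInter₂.2 ?_⟩
      rintro (_ | h) hh
      · exact absurd hh hn
      · refine ⟨hx.1, fun i hi => ?_⟩
        rw [Finset.mem_singleton.1 hi]
        exact hx.2 h (hF (Finset.mem_eraseNone.2 hh))

/-- If the values of sets of constraints coincide only when one set has a redundant element, then
the problem is nondegenerate. -/
theorem isNondegenerateLPType [LinearOrder H] [FiniteDimensional ℝ E]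
    (hP : IsRelaxedProgram K f g τ)
    (hgen : ∀ (F F' : Finset H) (i : H), i ∈ F → i ∉ F' →
      relaxedValue K f g τ (F.erase i) < relaxedValue K f g τ F →
      relaxedValue K f g τ F ≠ relaxedValue K f g τ F') :
    IsNondegenerateLPType (relaxedValue K f g τ) (Module.finrank ℝ E) := by
  set w := relaxedValue K f g τ with hwdef
  have hmono : Monotone w := hP.value_mono
  have key : ∀ R, ∃ F ⊆ R, F.card ≤ Module.finrank ℝ E ∧ w F = w R ∧ supportSet w R = F := by
    intro R
    obtain ⟨F₀, hF₀, hF₀c, hF₀v⟩ := hP.exists_subset_card_le_finrank R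
    obtain ⟨F, hF, hFmin⟩ := Finset.exists_min_image (R.powerset.filter fun F => w F = w R)
      Finset.card ⟨F₀, by simp [hF₀, hwdef, hF₀v]⟩
    simp only [Finset.mem_filter, Finset.mem_powerset] at hF hFmin
    refine ⟨F, hF.1, (hFmin F₀ ⟨hF₀, hF₀v⟩).trans hF₀c, hF.2, ?_⟩
    have hess : ∀ i ∈ F, w (F.erase i) < w F := by
      intro i hi
      refine lt_of_le_of_ne (hmono (Finset.erase_subset _ _)) fun he => ?_
      have := hFmin (F.erase i) ⟨(Finset.erase_subset _ _).trans hF.1, he.trans hF.2⟩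
      rw [Finset.card_erase_of_mem hi] at this
      have := Finset.card_pos.2 ⟨i, hi⟩
      omega
    ext i
    simp only [supportSet, Finset.mem_filter]
    constructor
    · rintro ⟨-, hi⟩
      by_contra hiF
      have h1 : F ⊆ R.erase i := fun x hx => Finset.mem_erase.2 ⟨fun e => hiF (e ▸ hx), hF.1 hx⟩
      exact absurd (hmono h1) (not_le.2 (hF.2 ▸ hi))
    · intro hi
      refine ⟨hF.1 hi, lt_of_le_of_ne (hmono (Finset.erase_subset _ _)) fun he => ?_⟩
      exact hgen F (R.erase i) i hi (Finset.notMem_erase _ _) (hess i hi) (hF.2.trans he.symm)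
  refine ⟨hmono, hP.locality, fun R => ?_, fun R => ?_⟩
  · obtain ⟨F, -, -, h1, h2⟩ := key R
    rw [h2, h1]
  · obtain ⟨F, -, h1, -, h2⟩ := key R
    rw [h2]
    exact h1

/-- Raising the bound of an essential constraint strictly lowers the value; so, with the other
bounds fixed, at most one bound `τ i` makes the values of `F ∋ i` and `F' ∌ i` coincide. -/
theorem value_ne_of_lt [DecidableEq H] {τ' : H → ℝ} (hP : IsRelaxedProgram K f g τ)
    (hP' : IsRelaxedProgram K f g τ') {i : H} (hne : ∀ j, j ≠ i → τ j = τ' j) (hi : τ i < τ' i)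
    {F F' : Finset H} (hiF : i ∈ F) (hiF' : i ∉ F')
    (hess : relaxedValue K f g τ (F.erase i) < relaxedValue K f g τ F)
    (heq : relaxedValue K f g τ F = relaxedValue K f g τ F') :
    relaxedValue K f g τ' F ≠ relaxedValue K f g τ' F' := by
  have hsame : ∀ G : Finset H, i ∉ G → relaxedRegion K g τ' G = relaxedRegion K g τ G := by
    intro G hG
    ext x
    refine and_congr_right fun _ => forall₂_congr fun h hh => ?_
    rw [hne h fun e => hG (e ▸ hh)]
  have hF' : relaxedValue K f g τ' F' = relaxedValue K f g τ F := by
    rw [heq, relaxedValue, hsame F' hiF', relaxedValue]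
  rw [hF']
  obtain ⟨y, hy, hyv, -⟩ := hP.exists_minimizer F
  obtain ⟨z, hz, hzv, -⟩ := hP.exists_minimizer (F.erase i)
  -- a small step from the old minimizer towards that of the problem without constraint `i`
  obtain ⟨θ, hθ0, hθ1, hθ⟩ : ∃ θ : ℝ, 0 < θ ∧ θ ≤ 1 ∧ (1 - θ) * τ i + θ * g i z ≤ τ' i := by
    have hlim : Tendsto (fun θ : ℝ => (1 - θ) * τ i + θ * g i z) (nhdsWithin 0 (Set.Ioi 0))
        (nhds ((1 - 0) * τ i + 0 * g i z)) :=
      (Continuous.tendsto (by fun_prop) 0).mono_left nhdsWithin_le_nhds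
    have h1 := hlim.eventually (gt_mem_nhds (show (1 - 0) * τ i + 0 * g i z < τ' i by simpa))
    have h2 : ∀ᶠ θ : ℝ in nhdsWithin 0 (Set.Ioi 0), θ ∈ Set.Ioc (0 : ℝ) 1 :=
      Ioc_mem_nhdsGT one_pos
    obtain ⟨θ, h3, h4⟩ := (h1.and h2).exists
    exact ⟨θ, h4.1, h4.2, h3.le⟩
  have h1θ : 0 ≤ 1 - θ := by linarith
  have hp : (1 - θ) • y + θ • z ∈ relaxedRegion K g τ' F := by
    refine ⟨hP.convex hy.1 hz.1 h1θ hθ0.le (by ring), fun h hh => ?_⟩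
    have hc := (hP.convex_con h).2 (Set.mem_univ y) (Set.mem_univ z) h1θ hθ0.le (by ring)
    simp only [smul_eq_mul] at hc
    by_cases hhi : h = i
    · subst hhi
      have := mul_le_mul_of_nonneg_left (hy.2 h hh) h1θ
      linarith
    · rw [← hne h hhi]
      have h3 := mul_le_mul_of_nonneg_left (hy.2 h hh) h1θ
      have h4 := mul_le_mul_of_nonneg_left (hz.2 h (Finset.mem_erase.2 ⟨hhi, hh⟩)) hθ0.le
      linarith
  have hc := hP.strictConvex_obj.convexOn.2 (Set.mem_univ y) (Set.mem_univ z) h1θ hθ0.le (by ring)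
  simp only [smul_eq_mul] at hc
  have hv := hP'.value_le hp
  have := mul_lt_mul_of_pos_left (show f z < f y by rw [hyv, hzv]; exact hess) hθ0
  refine ne_of_lt ?_
  rw [← hyv]
  linarith

end IsRelaxedProgram

/-- If, for each of finitely many types of badness `t`, at most one value of the coordinate `c t`
makes a point bad when the other coordinates are fixed, then arbitrarily small positive vectors are
good for all types. The proof counts the points of a fine grid. -/
theorem exists_pos_le_forall_not {T : Type*} [Fintype T] [Fintype H] [DecidableEq H] (c : T → H)
    (bad : T → (H → ℝ) → Prop) (ρ : ℝ) (hρ : 0 < ρ)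
    (hbad : ∀ t (τ τ' : H → ℝ), (∀ j, 0 < τ j) → (∀ j, 0 < τ' j) → (∀ j, j ≠ c t → τ j = τ' j) →
      τ (c t) < τ' (c t) → bad t τ → ¬ bad t τ') :
    ∃ τ : H → ℝ, (∀ j, 0 < τ j ∧ τ j ≤ ρ) ∧ ∀ t, ¬ bad t τ := by
  classical
  rcases isEmpty_or_nonempty H with hH | hH
  · exact ⟨fun _ => ρ, fun j => hH.elim j, fun t => hH.elim (c t)⟩
  set m := Fintype.card T + 1 with hm
  let τ : (H → Fin m) → H → ℝ := fun a j => ρ * ((a j : ℕ) + 1) / m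
  have hm0 : (0 : ℝ) < m := by positivity
  have hτpos : ∀ a j, 0 < τ a j := fun a j => by positivity
  have hτle : ∀ a j, τ a j ≤ ρ := fun a j => by
    rw [div_le_iff₀ hm0]
    refine mul_le_mul_of_nonneg_left ?_ hρ.le
    exact_mod_cast (a j).2
  have hτlt : ∀ (a b : H → Fin m) (i : H), a i < b i → τ a i < τ b i := fun a b i hab => by
    have : ((a i : ℕ) : ℝ) < (b i : ℕ) := by exact_mod_cast hab
    refine div_lt_div_of_pos_right (mul_lt_mul_of_pos_left (by linarith) hρ) hm0
  have hcard : ∀ t, (Finset.univ.filter fun a => bad t (τ a)).card ≤ m ^ (Fintype.card H - 1) := by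
    intro t
    have : m ^ (Fintype.card H - 1) = (Finset.univ : Finset ({j // j ≠ c t} → Fin m)).card := by
      rw [Finset.card_univ, Fintype.card_fun, Fintype.card_fin]
      congr 1
      rw [Fintype.card_subtype_compl]
      simp
    rw [this]
    refine Finset.card_le_card_of_injOn (fun a j => a j) (fun _ _ => Finset.mem_univ _) ?_
    intro a ha b hb hab
    simp only [Finset.coe_filter, Finset.mem_univ, true_and, Set.mem_ofPred_eq] at ha hb
    have hoff : ∀ j, j ≠ c t → a j = b j := fun j hj => congrFun hab ⟨j, hj⟩
    have hoffτ : ∀ j, j ≠ c t → τ a j = τ b j := fun j hj => by simp only [τ, hoff j hj]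
    rcases lt_trichotomy (a (c t)) (b (c t)) with hlt | heq | hgt
    · exact absurd hb (hbad t _ _ (hτpos a) (hτpos b) hoffτ (hτlt a b _ hlt) ha)
    · funext j
      by_cases hj : j = c t
      · rw [hj, heq]
      · exact hoff j hj
    · exact absurd ha (hbad t _ _ (hτpos b) (hτpos a) (fun j hj => (hoffτ j hj).symm)
        (hτlt b a _ hgt) hb)
  have hlt : (Finset.univ.biUnion fun t => Finset.univ.filter fun a => bad t (τ a)).card <
      (Finset.univ : Finset (H → Fin m)).card := by
    calc _ ≤ ∑ t : T, (Finset.univ.filter fun a => bad t (τ a)).card := Finset.card_biUnion_le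
      _ ≤ ∑ _t : T, m ^ (Fintype.card H - 1) := Finset.sum_le_sum fun t _ => hcard t
      _ = Fintype.card T * m ^ (Fintype.card H - 1) := by simp
      _ < m * m ^ (Fintype.card H - 1) :=
          Nat.mul_lt_mul_of_pos_right (by omega) (by positivity)
      _ = m ^ Fintype.card H := by
          rw [← pow_succ']
          congr 1
          have := Fintype.card_pos (α := H)
          omega
      _ = _ := by rw [Finset.card_univ, Fintype.card_fun, Fintype.card_fin]
  obtain ⟨a, -, ha⟩ := Finset.exists_mem_notMem_of_card_lt_card hlt
  refine ⟨τ a, fun j => ⟨hτpos a j, hτle a j⟩, fun t ht => ha ?_⟩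
  simp only [Finset.mem_biUnion, Finset.mem_univ, true_and, Finset.mem_filter]
  exact ⟨t, ht⟩

/-- Arbitrarily small relaxations make the program nondegenerate. -/
theorem exists_relaxation_isNondegenerateLPType [Fintype H] [LinearOrder H]
    [FiniteDimensional ℝ E] {K : Set E} {f : E → ℝ} {g : H → E → ℝ}
    (hP : ∀ τ : H → ℝ, (∀ j, 0 < τ j) → IsRelaxedProgram K f g τ) (ρ : ℝ) (hρ : 0 < ρ) :
    ∃ τ : H → ℝ, (∀ j, 0 < τ j ∧ τ j ≤ ρ) ∧
      IsNondegenerateLPType (relaxedValue K f g τ) (Module.finrank ℝ E) := by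
  obtain ⟨τ, hτ, hgood⟩ := exists_pos_le_forall_not (T := Finset H × Finset H × H)
    (fun t => t.2.2) (fun t τ => t.2.2 ∈ t.1 ∧ t.2.2 ∉ t.2.1 ∧
      relaxedValue K f g τ (t.1.erase t.2.2) < relaxedValue K f g τ t.1 ∧
      relaxedValue K f g τ t.1 = relaxedValue K f g τ t.2.1) ρ hρ (by
    rintro ⟨F, F', i⟩ τ τ' h0 h0' hne hlt ⟨h1, h2, h3, h4⟩ ⟨-, -, -, h5⟩
    exact (hP τ h0).value_ne_of_lt (hP τ' h0') hne hlt h1 h2 h3 h4 h5)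
  refine ⟨τ, hτ, (hP τ fun j => (hτ j).1).isNondegenerateLPType ?_⟩
  intro F F' i h1 h2 h3 h4
  exact hgood (F, F', i) ⟨h1, h2, h3, h4⟩

end Relaxation

/-! ### The number of violated constraints among finitely many -/

section FiniteScenarios

variable {H E : Type*} [NormedAddCommGroup E]

theorem convexOn_infDist [NormedSpace ℝ E] {Y : Set E} (hY : IsCompact Y) (hne : Y.Nonempty)
    (hc : Convex ℝ Y) : ConvexOn ℝ Set.univ fun x => Metric.infDist x Y := by
  refine ⟨convex_univ, fun x _ y _ a b ha hb hab => ?_⟩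
  obtain ⟨x', hx', hx⟩ := hY.exists_infDist_eq_dist hne x
  obtain ⟨y', hy', hy⟩ := hY.exists_infDist_eq_dist hne y
  simp only [smul_eq_mul, hx, hy]
  refine (Metric.infDist_le_dist_of_mem (hc hx' hy' ha hb hab)).trans ?_
  rw [dist_eq_norm, dist_eq_norm, dist_eq_norm]
  calc ‖a • x + b • y - (a • x' + b • y')‖ = ‖a • (x - x') + b • (y - y')‖ := by
        congr 1
        module
    _ ≤ ‖a • (x - x')‖ + ‖b • (y - y')‖ := norm_add_le _ _
    _ = a * ‖x - x'‖ + b * ‖y - y'‖ := by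
        rw [norm_smul, norm_smul, Real.norm_of_nonneg ha, Real.norm_of_nonneg hb]

variable [InnerProductSpace ℝ E]

theorem strictConvexOn_clm_add_mul_norm_sq (ℓ : E →L[ℝ] ℝ) {η : ℝ} (hη : 0 < η) :
    StrictConvexOn ℝ Set.univ fun x => ℓ x + η * ‖x‖ ^ 2 := by
  have : StrongConvexOn Set.univ (2 * η) fun x => ℓ x + η * ‖x‖ ^ 2 := by
    rw [strongConvexOn_iff_convex]
    refine (ℓ.toLinearMap.convexOn convex_univ).congr fun x _ => ?_
    simp only [ContinuousLinearMap.coe_coe]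
    ring
  exact this.strictConvexOn (by positivity)

omit [InnerProductSpace ℝ E] in
/-- Small relaxations do not reverse strict inequalities between optimal values: the points that
nearly satisfy all constraints have objective values beyond that of `x`. -/
theorem eventually_lt_of_forall_lt [NormedSpace ℝ E] {K : Set E} (hK : IsCompact K)
    (ℓ : E →L[ℝ] ℝ) (Y : H → Set E) (hY : ∀ h, IsClosed (Y h)) (hYne : ∀ h, (Y h).Nonempty)
    (R : Finset H) (x : E) (hR : ∀ y, (∀ h ∈ R, y ∈ Y h) → ℓ x < ℓ y) :
    ∀ᶠ ρ : ℝ in nhdsWithin 0 (Set.Ioi 0), ∀ y ∈ K, (∀ h ∈ R, Metric.infDist y (Y h) ≤ ρ) →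
      ℓ x + ρ * ‖x‖ ^ 2 < ℓ y := by
  rcases K.eq_empty_or_nonempty with rfl | hne
  · simp
  -- the objective gap of `y` and its total constraint violation do not vanish together
  let ψ : E → ℝ := fun y => ∑ h ∈ R, Metric.infDist y (Y h)
  have hψ : Continuous ψ := continuous_finsetSum _ fun h _ => Metric.continuous_infDist_pt _
  have hψ0 : ∀ y, 0 ≤ ψ y := fun y => Finset.sum_nonneg fun h _ => Metric.infDist_nonneg
  let φ : E → ℝ := fun y => max (ℓ y - ℓ x) 0 + ψ y
  have hφ : Continuous φ := by fun_prop
  obtain ⟨y₀, -, hmin⟩ := hK.exists_isMinOn hne hφ.continuousOn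
  have hpos : 0 < φ y₀ := by
    rcases (hψ0 y₀).lt_or_eq with h | h
    · exact add_pos_of_nonneg_of_pos (le_max_right _ _) h
    · refine add_pos_of_pos_of_nonneg (lt_max_of_lt_left (sub_pos.2 (hR y₀ fun h' hh' => ?_)))
        (hψ0 y₀)
      rw [(hY h').mem_iff_infDist_zero (hYne h')]
      exact (Finset.sum_eq_zero_iff_of_nonneg fun _ _ => Metric.infDist_nonneg).1 h.symm h' hh'
  have hlim : Tendsto (fun ρ : ℝ => R.card * ρ + ρ * ‖x‖ ^ 2) (nhdsWithin 0 (Set.Ioi 0))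
      (nhds (R.card * 0 + 0 * ‖x‖ ^ 2)) :=
    (Continuous.tendsto (by fun_prop) 0).mono_left nhdsWithin_le_nhds
  filter_upwards [hlim.eventually (gt_mem_nhds (by simpa using hpos)),
    (self_mem_nhdsWithin : ∀ᶠ ρ : ℝ in nhdsWithin 0 (Set.Ioi 0), ρ ∈ Set.Ioi (0 : ℝ))]
    with ρ h1 hρ y hyK hy
  have h2 : φ y₀ ≤ φ y := hmin hyK
  have h3 : ψ y ≤ R.card * ρ := by
    rw [← nsmul_eq_mul]
    exact Finset.sum_le_card_nsmul _ _ _ hy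
  have h4 : 0 ≤ ρ * ‖x‖ ^ 2 := mul_nonneg (le_of_lt hρ) (sq_nonneg _)
  have h5 : ρ * ‖x‖ ^ 2 < max (ℓ y - ℓ x) 0 := by
    have : φ y = max (ℓ y - ℓ x) 0 + ψ y := rfl
    linarith
  rcases lt_max_iff.1 h5 with h6 | h6 <;> linarith

/-- The combinatorial core. Let `xs R` be the unique minimizer of `ℓ` under the convex constraints
`A h`, `h ∈ R`. Then at most a hypergeometric count of the `R` with a given number of constraints
have a minimizer that violates `k` or more constraints. Only finitely many points matter, so each
`A h` may be shrunk to the polytope spanned by the `xs R` with `h ∈ R`; the polytopes are then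
thickened by small generic amounts and the objective is made strictly convex, which yields a
nondegenerate problem whose optimal values still separate those of the original one. -/
theorem card_filter_violated_le [FiniteDimensional ℝ E] [Fintype H] [LinearOrder H]
    (ℓ : E →L[ℝ] ℝ) (A : H → Set E) (hA : ∀ h, Convex ℝ (A h)) [∀ h x, Decidable (x ∉ A h)]
    (xs : Finset H → E) (hmem : ∀ R, R.Nonempty → ∀ h ∈ R, xs R ∈ A h)
    (hmin : ∀ R, R.Nonempty → ∀ y, (∀ h ∈ R, y ∈ A h) → y ≠ xs R → ℓ (xs R) < ℓ y)
    (e r k : ℕ) (he : Module.finrank ℝ E = e + 1) (hk : k + e ≤ Fintype.card H) :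
    ((Finset.powersetCard (r + e + 1) (Finset.univ : Finset H)).filter
      fun R => k ≤ (Finset.univ.filter fun h => xs R ∉ A h).card).card ≤
      hypergeomCount (Fintype.card H) (r + e + 1) (e + 1) (k + e) := by
  rcases isEmpty_or_nonempty H with hH | hH
  · rw [Finset.powersetCard_eq_empty.2 (by simp)]
    simp
  let Y : H → Set E := fun h => convexHull ℝ (xs '' {R | h ∈ R})
  let K : Set E := convexHull ℝ (xs '' {R | R.Nonempty})
  have hxsY : ∀ (R : Finset H), ∀ h ∈ R, xs R ∈ Y h := fun R h hh =>
    subset_convexHull ℝ _ ⟨R, hh, rfl⟩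
  have hxsK : ∀ R : Finset H, R.Nonempty → xs R ∈ K := fun R hR =>
    subset_convexHull ℝ _ ⟨R, hR, rfl⟩
  have hYA : ∀ h, Y h ⊆ A h := fun h => convexHull_min (by
    rintro _ ⟨R, hR, rfl⟩
    exact hmem R ⟨h, hR⟩ h hR) (hA h)
  have hYc : ∀ h, IsCompact (Y h) := fun h => (Set.toFinite _).isCompact_convexHull ℝ
  have hKc : IsCompact K := (Set.toFinite _).isCompact_convexHull ℝ
  have hYne : ∀ h, (Y h).Nonempty := fun h => ⟨_, hxsY {h} h (Finset.mem_singleton_self h)⟩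
  have hle : ∀ R : Finset H, R.Nonempty → ∀ y, (∀ h ∈ R, y ∈ A h) → ℓ (xs R) ≤ ℓ y := by
    intro R hR y hy
    by_cases h : y = xs R
    · rw [h]
    · exact (hmin R hR y hy h).le
  let g : H → E → ℝ := fun h x => Metric.infDist x (Y h)
  have hgxs : ∀ (R : Finset H), ∀ h ∈ R, g h (xs R) = 0 := fun R h hh =>
    Metric.infDist_zero_of_mem (hxsY R h hh)
  have hev : ∀ᶠ ρ : ℝ in nhdsWithin 0 (Set.Ioi 0), ∀ R R' : Finset H, R'.Nonempty →
      ℓ (xs R) < ℓ (xs R') → ∀ y ∈ K, (∀ h ∈ R', g h y ≤ ρ) →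
        ℓ (xs R) + ρ * ‖xs R‖ ^ 2 < ℓ y := by
    rw [eventually_all]
    intro R
    rw [eventually_all]
    intro R'
    by_cases hc : R'.Nonempty ∧ ℓ (xs R) < ℓ (xs R')
    · filter_upwards [eventually_lt_of_forall_lt hKc ℓ Y (fun h => (hYc h).isClosed) hYne R' (xs R)
        fun y hy => hc.2.trans_le (hle R' hc.1 y fun h hh => hYA h (hy h hh))] with ρ hρ _ _
      exact hρ
    · exact Eventually.of_forall fun ρ h1 h2 => absurd ⟨h1, h2⟩ hc
  obtain ⟨ρ, hρ, hρ0⟩ := (hev.and (self_mem_nhdsWithin :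
    ∀ᶠ ρ : ℝ in nhdsWithin 0 (Set.Ioi 0), ρ ∈ Set.Ioi (0 : ℝ))).exists
  let f : E → ℝ := fun x => ℓ x + ρ * ‖x‖ ^ 2
  have hP : ∀ τ : H → ℝ, (∀ j, 0 < τ j) → IsRelaxedProgram K f g τ := fun τ hτ =>
    { isCompact := hKc
      convex := convex_convexHull ℝ _
      continuous_obj := by fun_prop
      strictConvex_obj := strictConvexOn_clm_add_mul_norm_sq ℓ hρ0
      continuous_con := fun h => Metric.continuous_infDist_pt _
      convex_con := fun h => convexOn_infDist (hYc h) (hYne h) (convex_convexHull ℝ _)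
      feasible := ⟨xs Finset.univ, hxsK _ Finset.univ_nonempty, fun h => by
        rw [hgxs _ h (Finset.mem_univ h)]
        exact (hτ h).le⟩ }
  obtain ⟨τ, hτ, hw⟩ := exists_relaxation_isNondegenerateLPType hP ρ hρ0
  have hPτ := hP τ fun j => (hτ j).1
  rw [he] at hw
  set w := relaxedValue K f g τ
  have hsep : ∀ R R' : Finset H, R.Nonempty → R'.Nonempty → ℓ (xs R) < ℓ (xs R') → w R < w R' := by
    intro R R' hR hR' hlt
    obtain ⟨y, hy, hyv, -⟩ := hPτ.exists_minimizer R'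
    have h1 : w R ≤ f (xs R) := hPτ.value_le ⟨hxsK R hR, fun h hh => by
      rw [hgxs R h hh]
      exact (hτ h).1.le⟩
    have h2 := hρ R R' hR' hlt y hy.1 fun h hh => (hy.2 h hh).trans (hτ h).2
    have h3 : ℓ y ≤ f y := le_add_of_nonneg_right (mul_nonneg (le_of_lt hρ0) (sq_nonneg _))
    calc w R ≤ f (xs R) := h1
      _ < ℓ y := h2
      _ ≤ f y := h3
      _ = w R' := hyv
  refine hw.card_filter_harmless_le e r (k + e) hk _ ?_
  intro B R hBR hBc hwBR hharm hbad
  have hBne : B.Nonempty := Finset.card_pos.1 (by omega)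
  have hRne : R.Nonempty := hBne.mono hBR
  have hxs : xs R = xs B := by
    by_contra hne
    exact (hsep B R hBne hRne (hmin B hBne _ (fun h hh => hmem R hRne h (hBR hh)) hne)).ne hwBR
  have hdisj : Disjoint (harmless w B) (Finset.univ.filter fun h => xs R ∉ A h) := by
    rw [Finset.disjoint_left]
    intro h h1 h2
    have h3 := (Finset.mem_filter.1 h1).2.2.1
    have h4 := (Finset.mem_filter.1 h2).2
    have hine : (insert h B).Nonempty := Finset.insert_nonempty _ _
    refine (hsep B (insert h B) hBne hine (hmin B hBne _ (fun i hi =>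
      hmem _ hine i (Finset.mem_insert_of_mem hi)) fun heq => h4 ?_)).ne h3.symm
    rw [hxs, ← heq]
    exact hmem _ hine h (Finset.mem_insert_self _ _)
  have hdisj' : Disjoint B (harmless w B ∪ Finset.univ.filter fun h => xs R ∉ A h) := by
    rw [Finset.disjoint_left]
    intro h h1 h2
    rcases Finset.mem_union.1 h2 with h2 | h2
    · exact (Finset.mem_filter.1 h2).2.1 h1
    · exact (Finset.mem_filter.1 h2).2 (hmem R hRne h (hBR h1))
  have hc := Finset.card_le_univ (B ∪ (harmless w B ∪ Finset.univ.filter fun h => xs R ∉ A h))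
  rw [Finset.card_union_of_disjoint hdisj', Finset.card_union_of_disjoint hdisj] at hc
  omega

end FiniteScenarios

/-! ### Solutions of scenario programs -/

namespace ChanceProgram

variable {d : ℕ} {𝒴 : Type*}

theorem convex_scenarioRegion (C : ChanceProgram d 𝒴) (hconvex : ∀ ξ, Convex ℝ (C.safe ξ)) {m : ℕ}
    (hm : 1 ≤ m) (ξ : Fin m → 𝒴) : Convex ℝ (C.scenarioRegion ξ) := by
  have : C.scenarioRegion ξ = ⋂ i, C.safe (ξ i) := by
    ext x
    simp only [scenarioRegion, Set.mem_ofPred_eq, Set.mem_iInter]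
    exact ⟨fun h => h.2, fun h => ⟨C.safe_subset _ (h ⟨0, hm⟩), h⟩⟩
  rw [this]
  exact convex_iInter fun i => hconvex _

theorem IsScenarioSolution.congr {C : ChanceProgram d 𝒴} {m m' : ℕ} {ξ : Fin m → 𝒴}
    {ξ' : Fin m' → 𝒴} {x : EuclideanSpace ℝ (Fin d)} (h : Set.range ξ = Set.range ξ')
    (hx : C.IsScenarioSolution ξ x) : C.IsScenarioSolution ξ' x := by
  have : C.scenarioRegion ξ = C.scenarioRegion ξ' := by
    ext y
    refine and_congr_right fun _ => ?_
    rw [← Set.forall_mem_range (p := fun η => y ∈ C.safe η), h, Set.forall_mem_range]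
  rw [IsScenarioSolution, ← this]
  exact hx

/-- The optimal value of a scenario program is approached along a dense sequence, because the
feasible region is convex with nonempty interior, even though it need not be closed. -/
theorem exists_denseSeq_lt_iff (C : ChanceProgram d 𝒴) (hconvex : ∀ ξ, Convex ℝ (C.safe ξ))
    {m : ℕ} (hm : 1 ≤ m) (ξ : Fin m → 𝒴) (hint : (interior (C.scenarioRegion ξ)).Nonempty)
    {x : EuclideanSpace ℝ (Fin d)} (hx : C.IsScenarioSolution ξ x) (t : ℝ) :
    (∃ n, inner ℝ C.c (TopologicalSpace.denseSeq (EuclideanSpace ℝ (Fin d)) n) < t ∧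
      TopologicalSpace.denseSeq _ n ∈ C.scenarioRegion ξ) ↔ inner ℝ C.c x < t := by
  constructor
  · rintro ⟨n, h1, h2⟩
    exact (hx.2 _ h2).trans_lt h1
  · intro ht
    have hcl : x ∈ closure (interior (C.scenarioRegion ξ)) := by
      rw [(C.convex_scenarioRegion hconvex hm ξ).closure_interior_eq_closure_of_nonempty_interior
        hint]
      exact subset_closure hx.1
    have hopen : IsOpen {y : EuclideanSpace ℝ (Fin d) | inner ℝ C.c y < t} :=
      isOpen_lt (by fun_prop) continuous_const
    obtain ⟨y, hy1, hy2⟩ := mem_closure_iff.1 hcl _ hopen ht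
    obtain ⟨_, ⟨h1, h2⟩, n, rfl⟩ := (TopologicalSpace.denseRange_denseSeq
      (EuclideanSpace ℝ (Fin d))).inter_open_nonempty _ (hopen.inter isOpen_interior) ⟨y, hy1, hy2⟩
    exact ⟨n, h1, interior_subset h2⟩

theorem scenarioRegion_cons (C : ChanceProgram d 𝒴) {m : ℕ} (ξ : Fin m → 𝒴) (η : 𝒴) :
    C.scenarioRegion (Fin.cons η ξ : Fin (m + 1) → 𝒴) = C.scenarioRegion ξ ∩ C.safe η := by
  ext x
  simp only [scenarioRegion, Set.mem_ofPred_eq, Fin.forall_fin_succ, Fin.cons_zero, Fin.cons_succ,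
    Set.mem_inter_iff]
  tauto

/-- An additional scenario rules out the solution exactly when it raises the optimal value; as the
value is determined by a dense sequence, this event is measurable, although the solution itself need
not depend measurably on the scenarios. -/
theorem measurableSet_violation [MeasurableSpace 𝒴] (C : ChanceProgram d 𝒴)
    (hmeas : ∀ x, MeasurableSet {ξ | x ∈ C.safe ξ})
    (hconvex : ∀ ξ, Convex ℝ (C.safe ξ))
    (hinterior : ∀ m : ℕ, 1 ≤ m → ∀ ξ : Fin m → 𝒴, (interior (C.scenarioRegion ξ)).Nonempty)
    (hunique : ∀ m : ℕ, 1 ≤ m → ∀ ξ : Fin m → 𝒴, ∃! x, C.IsScenarioSolution ξ x)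
    {N : ℕ} (hN : 1 ≤ N) (xhat : (Fin N → 𝒴) → EuclideanSpace ℝ (Fin d))
    (hxhat : ∀ ξ, C.IsScenarioSolution ξ (xhat ξ)) :
    MeasurableSet {p : (Fin N → 𝒴) × 𝒴 | xhat p.1 ∉ C.safe p.2} := by
  let q := TopologicalSpace.denseSeq (EuclideanSpace ℝ (Fin d))
  have hreg : ∀ n, MeasurableSet {p : (Fin N → 𝒴) × 𝒴 | q n ∈ C.scenarioRegion p.1} := by
    intro n
    simp only [scenarioRegion, Set.mem_ofPred_eq]
    exact (MeasurableSet.const _).inter (MeasurableSet.congr (MeasurableSet.iInter fun i =>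
      (hmeas (q n)).preimage ((measurable_pi_apply i).comp measurable_fst)) (by ext p; simp; rfl))
  have hsafe : ∀ n, MeasurableSet {p : (Fin N → 𝒴) × 𝒴 | q n ∈ C.safe p.2} := fun n =>
    (hmeas (q n)).preimage measurable_snd
  have hlt : ∀ t : ℚ, MeasurableSet {p : (Fin N → 𝒴) × 𝒴 |
      (∃ n, inner ℝ C.c (q n) < (t : ℝ) ∧ q n ∈ C.scenarioRegion p.1)} := fun t =>
    MeasurableSet.congr (MeasurableSet.iUnion fun n => (MeasurableSet.const _).inter (hreg n))
      (by ext p; simp; rfl)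
  have hlt' : ∀ t : ℚ, MeasurableSet {p : (Fin N → 𝒴) × 𝒴 |
      (∃ n, inner ℝ C.c (q n) < (t : ℝ) ∧ q n ∈ C.scenarioRegion p.1 ∩ C.safe p.2)} := fun t =>
    MeasurableSet.congr (MeasurableSet.iUnion fun n =>
      (MeasurableSet.const _).inter ((hreg n).inter (hsafe n))) (by ext p; simp; rfl)
  have key : {p : (Fin N → 𝒴) × 𝒴 | xhat p.1 ∉ C.safe p.2} = ⋃ t : ℚ, {p : (Fin N → 𝒴) × 𝒴 |
      (∃ n, inner ℝ C.c (q n) < (t : ℝ) ∧ q n ∈ C.scenarioRegion p.1)} \ {p : (Fin N → 𝒴) × 𝒴 |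
      (∃ n, inner ℝ C.c (q n) < (t : ℝ) ∧ q n ∈ C.scenarioRegion p.1 ∩ C.safe p.2)} := by
    ext ⟨ξ, η⟩
    have h1 := C.exists_denseSeq_lt_iff hconvex hN ξ (hinterior N hN ξ) (hxhat ξ)
    obtain ⟨y, hy, -⟩ := hunique (N + 1) (by omega) (Fin.cons η ξ : Fin (N + 1) → 𝒴)
    have h2 := C.exists_denseSeq_lt_iff hconvex (by omega) _
      (hinterior (N + 1) (by omega) (Fin.cons η ξ : Fin (N + 1) → 𝒴)) hy
    rw [scenarioRegion_cons] at h2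
    have hy1 := hy.1
    rw [scenarioRegion_cons] at hy1
    simp only [Set.mem_ofPred_eq, Set.mem_iUnion, Set.mem_sdiff, q, h1, h2, not_lt]
    constructor
    · intro hv
      have hlt : inner ℝ C.c (xhat ξ) < inner ℝ C.c y := by
        refine lt_of_le_of_ne ((hxhat ξ).2 y hy1.1) fun he => hv ?_
        rw [(hunique N hN ξ).unique (hxhat ξ) ⟨hy1.1, fun z hz => he ▸ (hxhat ξ).2 z hz⟩]
        exact hy1.2
      obtain ⟨t, ht1, ht2⟩ := exists_rat_btwn hlt
      exact ⟨t, ht1, ht2.le⟩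
    · rintro ⟨t, ht1, ht2⟩ hs
      have := hy.2 (xhat ξ) (by rw [scenarioRegion_cons]; exact ⟨(hxhat ξ).1, hs⟩)
      linarith
  rw [key]
  exact MeasurableSet.iUnion fun t => (hlt t).diff (hlt' t)

end ChanceProgram

/-! ### Sampling and the law of large numbers -/

section Sampling

variable {𝒴 : Type*} [MeasurableSpace 𝒴]

/-- Chebyshev's inequality for the number of samples in `A`. -/
theorem pi_card_filter_mem_lt_le (Q : Measure 𝒴) [IsProbabilityMeasure Q] {A : Set 𝒴}
    [DecidablePred (· ∈ A)] (hA : MeasurableSet A) {a b : ℝ} (hab : a < b) (hb : b ≤ Q.real A)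
    (m : ℕ) (hm : 1 ≤ m) :
    (Measure.pi fun _ : Fin m => Q)
      {η | (Finset.univ.filter fun j => η j ∈ A).card < ⌈a * m⌉₊} ≤
      ENNReal.ofReal (1 / (4 * m * (b - a) ^ 2)) := by
  have hm0 : (0 : ℝ) < m := by exact_mod_cast hm
  let X : Fin m → 𝒴 → ℝ := fun _ => A.indicator 1
  have hXm : Measurable (A.indicator (1 : 𝒴 → ℝ)) := measurable_one.indicator hA
  have hX : MemLp (A.indicator (1 : 𝒴 → ℝ)) 2 Q := (memLp_const (1 : ℝ)).indicator hA
  have hvar : Var[A.indicator (1 : 𝒴 → ℝ); Q] ≤ 1 / 4 := by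
    refine (variance_le_sq_of_bounded (a := 0) (b := 1) (ae_of_all _ fun y => ?_)
      hXm.aemeasurable).trans (by norm_num)
    by_cases hy : y ∈ A <;> simp [hy]
  let S : (Fin m → 𝒴) → ℝ := ∑ j, fun η => X j (η j)
  have hXj : ∀ j : Fin m, MemLp (fun η : Fin m → 𝒴 => X j (η j)) 2
      (Measure.pi fun _ : Fin m => Q) := fun j =>
    hX.comp_measurePreserving (measurePreserving_eval (fun _ : Fin m => Q) j)
  have hS : MemLp S 2 (Measure.pi fun _ : Fin m => Q) := memLp_finsetSum' _ fun j _ => hXj j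
  have hSvar : Var[S; Measure.pi fun _ : Fin m => Q] ≤ m / 4 := by
    rw [variance_sum_pi (μ := fun _ : Fin m => Q) (X := X) fun _ => hX]
    refine (Finset.sum_le_card_nsmul _ _ (1 / 4) fun j _ => hvar).trans ?_
    simp
    linarith
  have hSint : (Measure.pi fun _ : Fin m => Q)[S] = m * Q.real A := by
    have h1 : ∀ j : Fin m, ∫ η, X j (η j) ∂(Measure.pi fun _ : Fin m => Q) = Q.real A := by
      intro j
      have h2 := integral_map (μ := Measure.pi fun _ : Fin m => Q)
        (measurable_pi_apply j).aemeasurable (f := A.indicator (1 : 𝒴 → ℝ))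
        hXm.aestronglyMeasurable
      rw [(measurePreserving_eval (fun _ : Fin m => Q) j).map_eq, integral_indicator_one hA] at h2
      exact h2.symm
    have h2 : S = fun η => ∑ j, X j (η j) := by
      ext η
      simp [S]
    rw [h2, integral_finsetSum _ fun j _ => (hXj j).integrable one_le_two]
    simp [h1]
  have hc : 0 < m * (b - a) := mul_pos hm0 (sub_pos.2 hab)
  refine (measure_mono fun η hη => ?_).trans
    ((meas_ge_le_variance_div_sq hS hc).trans (ENNReal.ofReal_le_ofReal ?_))
  · have h3 : ((Finset.univ.filter fun j => η j ∈ A).card : ℝ) < a * m := Nat.lt_ceil.1 hη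
    have h4 : S η = (Finset.univ.filter fun j => η j ∈ A).card := by
      simp [S, X, Set.indicator_apply]
    rw [Set.mem_ofPred_eq, hSint, h4]
    have h5 := mul_le_mul_of_nonneg_left hb hm0.le
    rw [abs_of_neg (by nlinarith)]
    nlinarith
  · rw [div_le_div_iff₀ (by positivity) (by have := sub_pos.2 hab; positivity)]
    have := mul_le_mul_of_nonneg_right hSvar (show 0 ≤ 4 * m * (b - a) ^ 2 by positivity)
    nlinarith

end Sampling

section Exchangeability

variable {𝒴 : Type*} [MeasurableSpace 𝒴]

open scoped Classical in
/-- Exchangeability turns a bound on the number of bad `N`-subsets of any fixed `N + m` scenarios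
into a bound on the probability that `N` scenarios are bad with respect to `m` further ones. -/
theorem choose_mul_measure_le_of_card_le {N m : ℕ} (Q : Measure 𝒴) [IsProbabilityMeasure Q]
    (S : Set (Fin N ⊕ Fin m → 𝒴)) (hS : MeasurableSet S) (G : ℕ)
    (σ : Finset (Fin N ⊕ Fin m) → Equiv.Perm (Fin N ⊕ Fin m))
    (hG : ∀ ω : Fin N ⊕ Fin m → 𝒴, ((Finset.powersetCard N Finset.univ).filter
      fun R => ω ∘ σ R ∈ S).card ≤ G) :
    ((N + m).choose N : ℝ≥0∞) * (Measure.pi fun _ : Fin N ⊕ Fin m => Q) S ≤ G := by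
  set μ := Measure.pi fun _ : Fin N ⊕ Fin m => Q
  have hmp : ∀ τ : Equiv.Perm (Fin N ⊕ Fin m),
      MeasurePreserving (fun ω : Fin N ⊕ Fin m → 𝒴 => ω ∘ τ) μ μ := by
    intro τ
    have h := measurePreserving_piCongrLeft (α := fun _ : Fin N ⊕ Fin m => 𝒴) (fun _ => Q) τ.symm
    convert h using 1
    ext ω i
    have := MeasurableEquiv.piCongrLeft_apply_apply (β := fun _ : Fin N ⊕ Fin m => 𝒴) τ.symm ω (τ i)
    simpa using this.symm
  have h1 : ∀ R, μ S = ∫⁻ ω, ((fun ω => ω ∘ σ R) ⁻¹' S).indicator 1 ω ∂μ := fun R => by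
    rw [lintegral_indicator_one ((hmp _).measurable hS),
      (hmp _).measure_preimage hS.nullMeasurableSet]
  calc ((N + m).choose N : ℝ≥0∞) * μ S
      = ∑ R ∈ Finset.powersetCard N (Finset.univ : Finset (Fin N ⊕ Fin m)), μ S := by
        simp
    _ = ∑ R ∈ Finset.powersetCard N (Finset.univ : Finset (Fin N ⊕ Fin m)),
          ∫⁻ ω, ((fun ω => ω ∘ σ R) ⁻¹' S).indicator 1 ω ∂μ :=
        Finset.sum_congr rfl fun R _ => h1 R
    _ = ∫⁻ ω, ∑ R ∈ Finset.powersetCard N (Finset.univ : Finset (Fin N ⊕ Fin m)),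
          ((fun ω => ω ∘ σ R) ⁻¹' S).indicator 1 ω ∂μ :=
        (lintegral_finsetSum _ fun R _ =>
          measurable_one.indicator ((hmp _).measurable hS)).symm
    _ ≤ ∫⁻ _, (G : ℝ≥0∞) ∂μ := by
        refine lintegral_mono fun ω => ?_
        have : ∑ R ∈ Finset.powersetCard N (Finset.univ : Finset (Fin N ⊕ Fin m)),
            ((fun ω => ω ∘ σ R) ⁻¹' S).indicator (1 : (Fin N ⊕ Fin m → 𝒴) → ℝ≥0∞) ω =
            (((Finset.powersetCard N Finset.univ).filter fun R => ω ∘ σ R ∈ S).card : ℝ≥0∞) := by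
          simp [Set.indicator_apply]
        rw [this]
        exact Nat.cast_le.2 (le_trans (le_of_eq (by congr)) (hG ω))
    _ = G := by simp

end Exchangeability

namespace ChanceProgram

variable {d : ℕ} {𝒴 : Type*}

open scoped Classical in
/-- Among the `N`-subsets of `N + m` scenarios, few have a scenario solution that violates many of
the other scenarios. -/
theorem card_filter_violations_le (C : ChanceProgram d 𝒴)
    (hconvex : ∀ ξ, Convex ℝ (C.safe ξ))
    (hunique : ∀ m : ℕ, 1 ≤ m → ∀ ξ : Fin m → 𝒴, ∃! x, C.IsScenarioSolution ξ x)
    {N : ℕ} (xhat : (Fin N → 𝒴) → EuclideanSpace ℝ (Fin d))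
    (hxhat : ∀ ξ, C.IsScenarioSolution ξ (xhat ξ)) (m e k : ℕ) (hd : d = e + 1) (hN : e + 1 ≤ N)
    (hk : k ≤ m) (σ : Finset (Fin N ⊕ Fin m) → Equiv.Perm (Fin N ⊕ Fin m))
    (hσ : ∀ R, R.card = N → (Finset.univ.map Function.Embedding.inl).map (σ R).toEmbedding = R)
    (ω : Fin N ⊕ Fin m → 𝒴) :
    ((Finset.powersetCard N Finset.univ).filter fun R =>
      k ≤ (Finset.univ.filter fun j : Fin m =>
        xhat (fun i => ω (σ R (Sum.inl i))) ∉ C.safe (ω (σ R (Sum.inr j)))).card).card ≤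
      hypergeomCount (N + m) N (e + 1) (k + e) := by
  let _ : LinearOrder (Fin N ⊕ Fin m) :=
    LinearOrder.lift' finSumFinEquiv finSumFinEquiv.injective
  have hex : ∀ R : Finset (Fin N ⊕ Fin m), R.Nonempty → ∃ x,
      C.IsScenarioSolution (fun i => ω (R.equivFin.symm i)) x := fun R hR =>
    (hunique R.card (Finset.card_pos.2 hR) _).exists
  let xs : Finset (Fin N ⊕ Fin m) → EuclideanSpace ℝ (Fin d) := fun R =>
    if hR : R.Nonempty then (hex R hR).choose else 0
  have hxs : ∀ R : Finset (Fin N ⊕ Fin m), R.Nonempty →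
      C.IsScenarioSolution (fun i => ω (R.equivFin.symm i)) (xs R) := fun R hR => by
    simp only [xs, dif_pos hR]
    exact (hex R hR).choose_spec
  have hforall : ∀ (R : Finset (Fin N ⊕ Fin m)) (p : Fin N ⊕ Fin m → Prop),
      (∀ i, p (R.equivFin.symm i)) ↔ ∀ h ∈ R, p h := fun R p =>
    ⟨fun hp h hh => by simpa using hp (R.equivFin ⟨h, hh⟩), fun hp i => hp _ (Subtype.coe_prop _)⟩
  obtain ⟨r, rfl⟩ : ∃ r, N = r + e + 1 := ⟨N - (e + 1), by omega⟩
  have hmain := card_filter_violated_le (innerSL ℝ C.c) (fun h => C.safe (ω h))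
    (fun h => hconvex _) xs
    (fun R hR => (hforall R fun h => xs R ∈ C.safe (ω h)).1 (hxs R hR).1.2)
    (fun R hR y hy hne => by
      have hyR : y ∈ C.scenarioRegion fun i => ω (R.equivFin.symm i) := by
        obtain ⟨h, hh⟩ := hR
        exact ⟨C.safe_subset _ (hy h hh), (hforall R fun h => y ∈ C.safe (ω h)).2 hy⟩
      refine lt_of_le_of_ne ((hxs R hR).2 y hyR) fun he => hne ?_
      refine (hunique R.card (Finset.card_pos.2 hR) _).unique ⟨hyR, fun z hz => ?_⟩ (hxs R hR)
      exact (le_of_eq he.symm).trans ((hxs R hR).2 z hz))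
    e r k (by simp [hd]) (by simp; omega)
  rw [Fintype.card_sum, Fintype.card_fin, Fintype.card_fin] at hmain
  refine le_trans (Finset.card_le_card fun R hR => ?_) hmain
  rw [Finset.mem_filter] at hR ⊢
  refine ⟨hR.1, hR.2.trans ?_⟩
  have hRc := (Finset.mem_powersetCard.1 hR.1).2
  have hRne : R.Nonempty := Finset.card_pos.1 (by omega)
  have hmemR : ∀ h, h ∈ R ↔ ∃ i, σ R (Sum.inl i) = h := fun h => by
    conv_lhs => rw [← hσ R hRc]
    simp [Equiv.eq_symm_apply]
  have hx : xs R = xhat fun i => ω (σ R (Sum.inl i)) := by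
    refine (hunique _ (by omega) _).unique ?_ (hxhat _)
    refine IsScenarioSolution.congr ?_ (hxs R hRne)
    ext y
    simp only [Set.mem_range]
    constructor
    · rintro ⟨i, rfl⟩
      obtain ⟨j, hj⟩ := (hmemR _).1 (R.equivFin.symm i).2
      exact ⟨j, by rw [hj]⟩
    · rintro ⟨j, rfl⟩
      exact ⟨R.equivFin ⟨_, (hmemR _).2 ⟨j, rfl⟩⟩, by simp⟩
  rw [← hx]
  refine Finset.card_le_card_of_injOn (fun j => σ R (Sum.inr j)) ?_ ?_
  · intro j hj
    simpa using hj
  · intro j _ j' _ h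
    exact Sum.inr_injective ((σ R).injective h)

open scoped Classical in
/-- A scenario solution whose violation probability exceeds `b` is violated by at least `a * m` of
`m` further samples, up to the error in Chebyshev's inequality; the combinatorial bound shows that
this is rare. -/
theorem measureReal_violation_mul_le [MeasurableSpace 𝒴] (C : ChanceProgram d 𝒴)
    (hmeas : ∀ x, MeasurableSet {ξ | x ∈ C.safe ξ})
    (hconvex : ∀ ξ, Convex ℝ (C.safe ξ))
    (hinterior : ∀ m : ℕ, 1 ≤ m → ∀ ξ : Fin m → 𝒴, (interior (C.scenarioRegion ξ)).Nonempty)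
    (hunique : ∀ m : ℕ, 1 ≤ m → ∀ ξ : Fin m → 𝒴, ∃! x, C.IsScenarioSolution ξ x)
    (Q : Measure 𝒴) [IsProbabilityMeasure Q]
    {N : ℕ} (xhat : (Fin N → 𝒴) → EuclideanSpace ℝ (Fin d))
    (hxhat : ∀ ξ, C.IsScenarioSolution ξ (xhat ξ)) (m e : ℕ) (hd : d = e + 1) (hN : e + 1 ≤ N)
    (hm : 1 ≤ m) {a b : ℝ} (hab : a < b) (ha1 : a ≤ 1) :
    ((N + m).choose N : ℝ) * ((Measure.pi fun _ : Fin N => Q).real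
      {ξ | b < Q.real {η | xhat ξ ∉ C.safe η}} * (1 - 1 / (4 * m * (b - a) ^ 2))) ≤
      hypergeomCount (N + m) N (e + 1) (⌈a * m⌉₊ + e) := by
  have hviol := C.measurableSet_violation hmeas hconvex hinterior hunique (by omega) xhat hxhat
  set k := ⌈a * m⌉₊ with hk
  have hkm : k ≤ m := Nat.ceil_le.2 (by nlinarith [(Nat.cast_nonneg m : (0 : ℝ) ≤ m)])
  let S' : Set ((Fin N → 𝒴) × (Fin m → 𝒴)) :=
    {p | k ≤ (Finset.univ.filter fun j : Fin m => xhat p.1 ∉ C.safe (p.2 j)).card}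
  have hcount : Measurable fun p : (Fin N → 𝒴) × (Fin m → 𝒴) =>
      (Finset.univ.filter fun j : Fin m => xhat p.1 ∉ C.safe (p.2 j)).card := by
    simp only [Finset.card_filter]
    refine Finset.measurable_fun_sum _ fun j _ => ?_
    refine Measurable.ite ?_ measurable_const measurable_const
    exact hviol.preimage (f := fun p : (Fin N → 𝒴) × (Fin m → 𝒴) => (p.1, p.2 j)) (by fun_prop)
  have hS' : MeasurableSet S' := measurableSet_le measurable_const hcount
  let Φ := MeasurableEquiv.sumPiEquivProdPi fun _ : Fin N ⊕ Fin m => 𝒴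
  have hΦ : MeasurePreserving Φ (Measure.pi fun _ : Fin N ⊕ Fin m => Q)
      ((Measure.pi fun _ : Fin N => Q).prod (Measure.pi fun _ : Fin m => Q)) :=
    measurePreserving_sumPiEquivProdPi fun _ => Q
  have hσex : ∀ R : Finset (Fin N ⊕ Fin m), ∃ σ : Equiv.Perm (Fin N ⊕ Fin m), R.card = N →
      (Finset.univ.map Function.Embedding.inl).map σ.toEmbedding = R := by
    intro R
    by_cases hR : R.card = N
    · obtain ⟨σ, hσ⟩ := Equiv.Perm.exists_map_finset_eq
        ((Finset.univ : Finset (Fin N)).map Function.Embedding.inl) R (by simp [hR])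
      exact ⟨σ, fun _ => hσ⟩
    · exact ⟨1, fun h => absurd h hR⟩
  choose σ hσ using hσex
  have hcomb := choose_mul_measure_le_of_card_le Q (Φ ⁻¹' S') (Φ.measurable hS')
    (hypergeomCount (N + m) N (e + 1) (k + e)) σ
    (fun ω => le_trans (le_of_eq (by
      congr 1
      ext R
      simp only [Finset.mem_filter]
      rfl))
      (C.card_filter_violations_le hconvex hunique xhat hxhat m e k hd hN hkm σ hσ ω))
  rw [hΦ.measure_preimage hS'.nullMeasurableSet, Measure.prod_apply hS'] at hcomb
  set c : ℝ := 1 / (4 * m * (b - a) ^ 2)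
  set V : Set (Fin N → 𝒴) := {ξ | b < Q.real {η | xhat ξ ∉ C.safe η}}
  have hV : MeasurableSet V := by
    have h1 : Measurable fun ξ : Fin N → 𝒴 => Q (Prod.mk ξ ⁻¹' {p | xhat p.1 ∉ C.safe p.2}) :=
      measurable_measure_prodMk_left hviol
    exact measurableSet_lt measurable_const h1.ennreal_toReal
  have hlow : ∀ ξ, V.indicator (fun _ => ENNReal.ofReal (1 - c)) ξ ≤
      (Measure.pi fun _ : Fin m => Q) (Prod.mk ξ ⁻¹' S') := by
    intro ξ
    by_cases hξ : ξ ∈ V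
    · rw [Set.indicator_of_mem hξ]
      have hA : MeasurableSet {η | xhat ξ ∉ C.safe η} := (hmeas _).compl
      have hche := pi_card_filter_mem_lt_le Q hA hab (le_of_lt hξ) m hm
      have hcompl : (Prod.mk ξ ⁻¹' S')ᶜ =
          {η : Fin m → 𝒴 | (Finset.univ.filter fun j => η j ∈ {η | xhat ξ ∉ C.safe η}).card < k} := by
        ext η
        simp [S']
      rw [← hcompl, prob_compl_eq_one_sub (measurable_prodMk_left hS')] at hche
      rw [ENNReal.ofReal_sub _ (by positivity), ENNReal.ofReal_one]
      exact tsub_le_iff_tsub_le.1 hche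
    · rw [Set.indicator_of_notMem hξ]
      exact zero_le
  have hfin : ((N + m).choose N : ℝ≥0∞) * (ENNReal.ofReal (1 - c) *
      (Measure.pi fun _ : Fin N => Q) V) ≤ hypergeomCount (N + m) N (e + 1) (k + e) := by
    refine le_trans (mul_le_mul_right ?_ _) hcomb
    rw [← lintegral_indicator_const hV]
    exact lintegral_mono hlow
  rcases le_total (1 - c) 0 with hc | hc
  · refine le_trans ?_ (Nat.cast_nonneg _)
    exact mul_nonpos_of_nonneg_of_nonpos (Nat.cast_nonneg _)
      (mul_nonpos_of_nonneg_of_nonpos measureReal_nonneg hc)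
  · have := ENNReal.toReal_mono (ENNReal.natCast_ne_top _) hfin
    rw [ENNReal.toReal_mul, ENNReal.toReal_mul, ENNReal.toReal_ofReal hc, ENNReal.toReal_natCast,
      ENNReal.toReal_natCast] at this
    rwa [mul_comm (Measure.real _ _)]

end ChanceProgram

/-! ### From hypergeometric to binomial tails -/

theorem tendsto_choose_div_pow {a : ℕ → ℕ} {x : ℝ}
    (ha : Tendsto (fun m => (a m : ℝ) / m) atTop (nhds x)) (i : ℕ) :
    Tendsto (fun m => ((a m).choose i : ℝ) / (m : ℝ) ^ i) atTop (nhds (x ^ i / i.factorial)) := by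
  have hdesc : Tendsto (fun m => ((a m).descFactorial i : ℝ) / (m : ℝ) ^ i) atTop
      (nhds (x ^ i)) := by
    induction i with
    | zero => simp
    | succ i ih =>
      have hsub : Tendsto (fun m => ((a m - i : ℕ) : ℝ) / m) atTop (nhds x) := by
        have h0 : Tendsto (fun m : ℕ => (a m : ℝ) / m - i / m) atTop (nhds (x - 0)) :=
          ha.sub (tendsto_const_div_atTop_nhds_zero_nat (i : ℝ))
        rw [sub_zero] at h0
        refine tendsto_of_tendsto_of_tendsto_of_le_of_le h0 ha (fun m => ?_) fun m => ?_
        · rw [← sub_div]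
          refine div_le_div_of_nonneg_right ?_ (Nat.cast_nonneg _)
          rw [sub_le_iff_le_add]
          rw [← Nat.cast_add]
          exact Nat.cast_le.2 (by omega)
        · refine div_le_div_of_nonneg_right ?_ (Nat.cast_nonneg _)
          exact Nat.cast_le.2 (Nat.sub_le _ _)
      rw [pow_succ']
      refine (hsub.mul ih).congr fun m => ?_
      rw [Nat.descFactorial_succ, pow_succ']
      push_cast
      rw [div_mul_div_comm]
  refine (hdesc.div_const (i.factorial : ℝ)).congr fun m => ?_
  rw [Nat.descFactorial_eq_factorial_mul_choose]
  push_cast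
  field_simp

theorem tendsto_hypergeomCount_div_choose (N e : ℕ) (hN : e + 1 ≤ N) {a : ℝ} (ha0 : 0 ≤ a)
    (ha1 : a ≤ 1) :
    Tendsto (fun m : ℕ => (hypergeomCount (N + m) N (e + 1) (⌈a * m⌉₊ + e) : ℝ) /
      ((N + m).choose N : ℝ)) atTop
      (nhds (∑ i ∈ Finset.range (e + 1), (N.choose i : ℝ) * a ^ i * (1 - a) ^ (N - i))) := by
  have hcst : ∀ c : ℝ, Tendsto (fun m : ℕ => c / m) atTop (nhds 0) := fun c =>
    tendsto_const_div_atTop_nhds_zero_nat c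
  have hone : Tendsto (fun m : ℕ => (m : ℝ) / m) atTop (nhds 1) :=
    tendsto_const_nhds.congr' ((eventually_gt_atTop 0).mono fun m hm => by
      exact (div_self (by positivity)).symm)
  have hq : Tendsto (fun m : ℕ => ((⌈a * m⌉₊ + e : ℕ) : ℝ) / m) atTop (nhds a) := by
    have h1 : Tendsto (fun m : ℕ => (⌈a * m⌉₊ : ℝ) / m) atTop (nhds a) :=
      (tendsto_nat_ceil_mul_div_atTop ha0).comp tendsto_natCast_atTop_atTop
    simpa [add_div] using h1.add (hcst e)
  have hn : Tendsto (fun m : ℕ => ((N + m : ℕ) : ℝ) / m) atTop (nhds 1) := by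
    simpa [add_div] using (hcst N).add hone
  have hnq : Tendsto (fun m : ℕ => ((N + m - (⌈a * m⌉₊ + e) : ℕ) : ℝ) / m) atTop
      (nhds (1 - a)) := by
    refine (hn.sub hq).congr fun m => ?_
    have : ⌈a * m⌉₊ ≤ m := Nat.ceil_le.2 (by nlinarith [(Nat.cast_nonneg m : (0 : ℝ) ≤ m)])
    rw [Nat.cast_sub (by omega), sub_div]
  have hden := tendsto_choose_div_pow hn N
  rw [one_pow] at hden
  have hterm : ∀ i ∈ Finset.range (e + 1), Tendsto (fun m : ℕ =>
      (((⌈a * m⌉₊ + e).choose i * (N + m - (⌈a * m⌉₊ + e)).choose (N - i) : ℕ) : ℝ) /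
        ((N + m).choose N : ℝ)) atTop
      (nhds ((N.choose i : ℝ) * a ^ i * (1 - a) ^ (N - i))) := by
    intro i hi
    have hiN : i ≤ N := by
      have := Finset.mem_range.1 hi
      omega
    have h := ((tendsto_choose_div_pow hq i).mul (tendsto_choose_div_pow hnq (N - i))).div hden
      (by positivity)
    have hlim : a ^ i / i.factorial * ((1 - a) ^ (N - i) / (N - i).factorial) /
        (1 / N.factorial) = (N.choose i : ℝ) * a ^ i * (1 - a) ^ (N - i) := by
      rw [Nat.cast_choose ℝ hiN]
      field_simp
    rw [hlim] at h
    refine h.congr' ((eventually_gt_atTop 0).mono fun m hm => ?_)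
    have hm' : (m : ℝ) ≠ 0 := by positivity
    have hc : ((N + m).choose N : ℝ) ≠ 0 := by
      exact_mod_cast (Nat.choose_pos (Nat.le_add_right N m)).ne'
    simp only [Pi.div_apply]
    rw [div_mul_div_comm, ← pow_add, Nat.add_sub_cancel' hiN, div_div_div_cancel_right₀
      (pow_ne_zero _ hm')]
    push_cast
    rfl
  have := tendsto_finsetSum _ hterm
  refine this.congr fun m => ?_
  rw [← Finset.sum_div, hypergeomCount]
  push_cast
  rfl

namespace ChanceProgram

variable {d : ℕ} {𝒴 : Type*} [MeasurableSpace 𝒴]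

/-- The violation probability of the solution of a scenario program with `N` scenarios is
stochastically dominated by the `d`-th smallest of `N` uniform random variables. -/
theorem measureReal_violation_le (C : ChanceProgram d 𝒴)
    (hmeas : ∀ x, MeasurableSet {ξ | x ∈ C.safe ξ})
    (hconvex : ∀ ξ, Convex ℝ (C.safe ξ))
    (hinterior : ∀ m : ℕ, 1 ≤ m → ∀ ξ : Fin m → 𝒴, (interior (C.scenarioRegion ξ)).Nonempty)
    (hunique : ∀ m : ℕ, 1 ≤ m → ∀ ξ : Fin m → 𝒴, ∃! x, C.IsScenarioSolution ξ x)
    (Q : Measure 𝒴) [IsProbabilityMeasure Q]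
    {N : ℕ} (xhat : (Fin N → 𝒴) → EuclideanSpace ℝ (Fin d))
    (hxhat : ∀ ξ, C.IsScenarioSolution ξ (xhat ξ)) (hd : 1 ≤ d) (hN : d ≤ N) {b : ℝ} (hb0 : 0 < b)
    (hb1 : b < 1) :
    (Measure.pi fun _ : Fin N => Q).real {ξ | b < Q.real {η | xhat ξ ∉ C.safe η}} ≤
      ∑ i ∈ Finset.range d, (N.choose i : ℝ) * b ^ i * (1 - b) ^ (N - i) := by
  obtain ⟨e, he⟩ : ∃ e, d = e + 1 := ⟨d - 1, by omega⟩
  set p := (Measure.pi fun _ : Fin N => Q).real {ξ | b < Q.real {η | xhat ξ ∉ C.safe η}}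
  have key : ∀ a ∈ Set.Ioo 0 b,
      p ≤ ∑ i ∈ Finset.range d, (N.choose i : ℝ) * a ^ i * (1 - a) ^ (N - i) := by
    rintro a ⟨ha0, hab⟩
    have hlim := tendsto_hypergeomCount_div_choose N e (by omega) ha0.le (by linarith)
    rw [← he] at hlim
    have hlim' : Tendsto (fun m : ℕ => p * (1 - 1 / (4 * m * (b - a) ^ 2))) atTop
        (nhds (p * (1 - 0))) := by
      refine tendsto_const_nhds.mul (tendsto_const_nhds.sub ?_)
      refine (tendsto_const_div_atTop_nhds_zero_nat (1 / (4 * (b - a) ^ 2))).congr fun m => ?_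
      rw [div_div]
      ring_nf
    rw [sub_zero, mul_one] at hlim'
    refine le_of_tendsto_of_tendsto hlim' hlim ((eventually_ge_atTop 1).mono fun m hm => ?_)
    have hc : (0 : ℝ) < ((N + m).choose N : ℝ) := by
      exact_mod_cast Nat.choose_pos (Nat.le_add_right N m)
    rw [le_div_iff₀ hc, mul_comm]
    have := C.measureReal_violation_mul_le hmeas hconvex hinterior hunique Q xhat hxhat m e he
      (by omega) hm hab (by linarith)
    rwa [← he] at this
  have hcont : Tendsto (fun a : ℝ =>
      ∑ i ∈ Finset.range d, (N.choose i : ℝ) * a ^ i * (1 - a) ^ (N - i))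
      (nhdsWithin b (Set.Iio b))
      (nhds (∑ i ∈ Finset.range d, (N.choose i : ℝ) * b ^ i * (1 - b) ^ (N - i))) :=
    (Continuous.tendsto (by fun_prop) b).mono_left nhdsWithin_le_nhds
  exact ge_of_tendsto hcont (eventually_of_mem (Ioo_mem_nhdsLT hb0) key)

end ChanceProgram

/-! ### The sample size and the coverage of the data-driven program -/

theorem sum_binomial_eq_one {n d : ℕ} (h : n < d) (δ : ℝ) :
    ∑ i ∈ Finset.range d, (n.choose i : ℝ) * δ ^ i * (1 - δ) ^ (n - i) = 1 := by
  rw [← Finset.sum_subset (Finset.range_subset_range.2 (Nat.succ_le_of_lt h)) fun i _ hi => by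
    rw [Nat.choose_eq_zero_of_lt (by simpa using hi)]
    simp]
  have := add_pow δ (1 - δ) n
  rw [add_sub_cancel, one_pow] at this
  exact (Finset.sum_congr rfl fun i _ => by ring).trans this.symm

theorem tendsto_sum_binomial (d : ℕ) {δ : ℝ} (h0 : 0 < δ) (h1 : δ < 1) :
    Tendsto (fun n : ℕ => ∑ i ∈ Finset.range d, (n.choose i : ℝ) * δ ^ i * (1 - δ) ^ (n - i))
      atTop (nhds 0) := by
  rw [← Finset.sum_const_zero (s := Finset.range d)]
  refine tendsto_finsetSum _ fun i _ => ?_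
  rw [← tendsto_add_atTop_iff_nat i]
  have hs := (summable_choose_mul_geometric_of_norm_lt_one i (r := 1 - δ) (by
    rw [Real.norm_of_nonneg (by linarith)]
    linarith)).tendsto_atTop_zero
  have := hs.const_mul (δ ^ i)
  rw [mul_zero] at this
  refine this.congr fun n => ?_
  rw [Nat.add_sub_cancel]
  ring

theorem exactSampleSize_spec {δ β : ℝ} (hδ : 0 < δ) (hβ : 0 < β) (d : ℕ) :
    ∑ i ∈ Finset.range d, ((exactSampleSize δ β d).choose i : ℝ) * δ ^ i *
      (1 - δ) ^ (exactSampleSize δ β d - i) ≤ β := by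
  refine Nat.sInf_mem (s := {n : ℕ | ∑ i ∈ Finset.range d,
    (n.choose i : ℝ) * δ ^ i * (1 - δ) ^ (n - i) ≤ β}) ?_
  rcases lt_or_ge δ 1 with h1 | h1
  · exact ((tendsto_sum_binomial d hδ h1).eventually (ge_mem_nhds hβ)).exists
  · -- for `δ ≥ 1` the sum with `n = d` is `1 - δ ^ d`
    refine ⟨d, ?_⟩
    have h2 := sum_binomial_eq_one (Nat.lt_succ_self d) δ
    rw [Finset.sum_range_succ] at h2
    simp only [Nat.choose_self, Nat.cast_one, one_mul, Nat.sub_self, pow_zero, mul_one] at h2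
    have h3 : 1 ≤ δ ^ d := one_le_pow₀ h1
    rw [Set.mem_ofPred_eq]
    linarith

theorem le_exactSampleSize {δ β : ℝ} (hδ : 0 < δ) (hβ : 0 < β) (hβ1 : β < 1) (d : ℕ) :
    d ≤ exactSampleSize δ β d := by
  by_contra! h
  have := exactSampleSize_spec hδ hβ d
  rw [sum_binomial_eq_one h] at this
  linarith

theorem measure_le_boundingFunction {𝒴 : Type*} [MeasurableSpace 𝒴] {P₀ : Measure 𝒴}
    {U : Set (ProbabilityMeasure 𝒴)} {δ : ℝ} {Q : ProbabilityMeasure 𝒴} (hQ : Q ∈ U) {A : Set 𝒴}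
    (hA : MeasurableSet A) (h : P₀ A ≤ ENNReal.ofReal δ) :
    (Q : Measure 𝒴) A ≤ boundingFunction P₀ U δ :=
  le_iSup₂_of_le Q hQ (le_iSup_of_le A (le_iSup₂_of_le hA h le_rfl))

/-- If the uncertainty set contains the true distribution, the Monte Carlo solution is feasible with
conditional probability at least `1 - β`. -/
theorem ChanceProgram.ofReal_le_measure_isFeasible {d : ℕ} {𝒴 : Type*} [MeasurableSpace 𝒴]
    (C : ChanceProgram d 𝒴)
    (hmeas : ∀ x, MeasurableSet {ξ | x ∈ C.safe ξ})
    (hconvex : ∀ ξ, Convex ℝ (C.safe ξ))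
    (hinterior : ∀ m : ℕ, 1 ≤ m → ∀ ξ : Fin m → 𝒴, (interior (C.scenarioRegion ξ)).Nonempty)
    (hunique : ∀ m : ℕ, 1 ≤ m → ∀ ξ : Fin m → 𝒴, ∃! x, C.IsScenarioSolution ξ x)
    (xhat : ∀ m : ℕ, (Fin m → 𝒴) → EuclideanSpace ℝ (Fin d))
    (hxhat : ∀ m : ℕ, 1 ≤ m → ∀ ξ : Fin m → 𝒴, C.IsScenarioSolution ξ (xhat m ξ))
    (P : ProbabilityMeasure 𝒴) (U : Set (ProbabilityMeasure 𝒴)) (hPU : P ∈ U)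
    (Q : Measure 𝒴) [IsProbabilityMeasure Q] {ε β δ : ℝ} (hε : 0 < ε) (hβ : 0 < β) (hδ : 0 < δ)
    (hbound : boundingFunction Q U δ ≤ ENNReal.ofReal ε) :
    ENNReal.ofReal (1 - β) ≤ Measure.pi (fun _ : Fin (exactSampleSize δ β d) => Q)
      {ξ | C.IsFeasible P ε (xhat _ ξ)} := by
  rcases le_or_gt 1 β with hβ1 | hβ1
  · rw [ENNReal.ofReal_of_nonpos (by linarith)]
    exact zero_le
  have hone : ENNReal.ofReal (1 - β) ≤ 1 := by
    rw [← ENNReal.ofReal_one]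
    exact ENNReal.ofReal_le_ofReal (by linarith)
  have hN := le_exactSampleSize hδ hβ hβ1 d
  have hsum := exactSampleSize_spec hδ hβ d
  set N := exactSampleSize δ β d
  rcases Nat.eq_zero_or_pos d with rfl | hd
  · -- every scenario set is nonempty, hence all of the one-point space
    have hall : ∀ ξ x, x ∈ C.safe ξ := fun ξ x => by
      obtain ⟨y, hy⟩ := hinterior 1 le_rfl fun _ => ξ
      rw [Subsingleton.elim x y]
      exact (interior_subset hy).2 0
    have huniv : {ξ : Fin N → 𝒴 | C.IsFeasible P ε (xhat _ ξ)} = Set.univ := by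
      obtain ⟨η⟩ : Nonempty 𝒴 := nonempty_of_isProbabilityMeasure Q
      refine Set.eq_univ_of_forall fun ξ => ⟨C.safe_subset η (hall _ _), ?_⟩
      rw [show {η | xhat N ξ ∈ C.safe η} = Set.univ from Set.eq_univ_of_forall fun η => hall _ _,
        probReal_univ]
      linarith
    rw [huniv, measure_univ]
    exact hone
  · have hN1 : 1 ≤ N := le_trans hd hN
    rcases lt_or_ge δ 1 with hδ1 | hδ1
    · set V : Set (Fin N → 𝒴) := {ξ | δ < Q.real {η | xhat N ξ ∉ C.safe η}}
      have hV : MeasurableSet V := by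
        have h1 : Measurable fun ξ : Fin N → 𝒴 => Q (Prod.mk ξ ⁻¹' {p | xhat N p.1 ∉ C.safe p.2}) :=
          measurable_measure_prodMk_left
            (C.measurableSet_violation hmeas hconvex hinterior hunique hN1 (xhat N) (hxhat N hN1))
        exact measurableSet_lt measurable_const h1.ennreal_toReal
      have hVβ := (C.measureReal_violation_le hmeas hconvex hinterior hunique Q (xhat N)
        (hxhat N hN1) hd hN hδ hδ1).trans hsum
      refine le_trans ?_ (measure_mono (s := Vᶜ) fun ξ hξ => ?_)
      · rw [← ofReal_measureReal, probReal_compl_eq_one_sub hV]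
        exact ENNReal.ofReal_le_ofReal (by linarith)
      · have hA : MeasurableSet {η | xhat N ξ ∈ C.safe η} := hmeas _
        have h1 : Q {η | xhat N ξ ∉ C.safe η} ≤ ENNReal.ofReal δ := by
          rw [← ofReal_measureReal]
          exact ENNReal.ofReal_le_ofReal (not_lt.1 hξ)
        have h2 := (measure_le_boundingFunction hPU hA.compl h1).trans hbound
        refine ⟨(hxhat N hN1 ξ).1.1, ?_⟩
        have h3 : (P : Measure 𝒴).real {η | xhat N ξ ∈ C.safe η}ᶜ ≤ ε :=
          ENNReal.toReal_le_of_le_ofReal hε.le h2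
        rw [probReal_compl_eq_one_sub hA] at h3
        linarith
    · -- for `δ ≥ 1` the bound forces `ε ≥ 1`, so that every point of the domain is feasible
      have h1 : Q Set.univ ≤ ENNReal.ofReal δ := by
        rw [measure_univ, ← ENNReal.ofReal_one]
        exact ENNReal.ofReal_le_ofReal hδ1
      have h2 := (measure_le_boundingFunction hPU MeasurableSet.univ h1).trans hbound
      rw [measure_univ, ENNReal.one_le_ofReal] at h2
      have huniv : {ξ : Fin N → 𝒴 | C.IsFeasible P ε (xhat _ ξ)} = Set.univ :=
        Set.eq_univ_of_forall fun ξ => ⟨(hxhat N hN1 ξ).1.1,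
          le_trans (by linarith) measureReal_nonneg⟩
      rw [huniv, measure_univ]
      exact hone

theorem mainTheorem2 {d : ℕ} {𝒴 : Type*} [MeasurableSpace 𝒴]
    -- the chance-constrained program, with the standing assumptions of scenario optimization
    (C : ChanceProgram d 𝒴)
    (hmeas : ∀ x, MeasurableSet {ξ | x ∈ C.safe ξ})
    (hconvex : ∀ ξ, Convex ℝ (C.safe ξ))
    (hinterior : ∀ m : ℕ, 1 ≤ m → ∀ ξ : Fin m → 𝒴, (interior (C.scenarioRegion ξ)).Nonempty)
    (hunique : ∀ m : ℕ, 1 ≤ m → ∀ ξ : Fin m → 𝒴, ∃! x, C.IsScenarioSolution ξ x)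
    -- the solution of the scenario program
    (xhat : ∀ m : ℕ, (Fin m → 𝒴) → EuclideanSpace ℝ (Fin d))
    (hxhat : ∀ m : ℕ, 1 ≤ m → ∀ ξ : Fin m → 𝒴, C.IsScenarioSolution ξ (xhat m ξ))
    -- true distribution, data-driven uncertainty sets, data-driven generating distributions
    (P : ProbabilityMeasure 𝒴)
    (U : ∀ n : ℕ, (Fin n → 𝒴) → Set (ProbabilityMeasure 𝒴))
    (hU : ∀ n, MeasurableSet {D : Fin n → 𝒴 | P ∈ U n D})
    (P₀ : ∀ n : ℕ, Kernel (Fin n → 𝒴) 𝒴) [∀ n, IsMarkovKernel (P₀ n)]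
    (ε α β : ℝ) (hε : 0 < ε) (hβ : 0 < β)
    -- the adjusted tolerance level
    (δ : ∀ n : ℕ, (Fin n → 𝒴) → ℝ)
    (hδmeas : ∀ n, Measurable (δ n))
    (hδpos : ∀ n D, 0 < δ n D)
    (hδ : ∀ n, ∀ᵐ D ∂(dataLaw P n),
      boundingFunction (P₀ n D) (U n D) (δ n D) ≤ ENNReal.ofReal ε)
    -- asymptotic coverage
    (hcover : 1 - α ≤ liminf (fun n : ℕ => (dataLaw P n).real {D | P ∈ U n D}) atTop) :
    1 - α - β ≤ liminf (fun n : ℕ =>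
      (jointConfidence P (P₀ n) (fun D => exactSampleSize (δ n D) β d)
        (fun m => {ξMC | C.IsFeasible P ε (xhat m ξMC)})).toReal) atTop := by
  have hdata : ∀ n, IsProbabilityMeasure (dataLaw P n) := fun n => by
    unfold dataLaw
    infer_instance
  let J : ℕ → ℝ≥0∞ := fun n => jointConfidence P (P₀ n) (fun D => exactSampleSize (δ n D) β d)
    (fun m => {ξMC | C.IsFeasible P ε (xhat m ξMC)})
  have hJ1 : ∀ n, J n ≤ 1 := fun n => by
    refine (lintegral_mono fun D => prob_le_one).trans ?_
    simp
  -- the bound holds for each sample size, without passing to the limit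
  have hle : ∀ n : ℕ, (dataLaw P n).real {D | P ∈ U n D} - β ≤ (J n).toReal := by
    intro n
    have hlow : ENNReal.ofReal (1 - β) * dataLaw P n {D | P ∈ U n D} ≤ J n := by
      rw [← lintegral_indicator_const (hU n)]
      refine lintegral_mono_ae ?_
      filter_upwards [hδ n] with D hD
      by_cases hDU : D ∈ {D | P ∈ U n D}
      · rw [Set.indicator_of_mem hDU]
        exact C.ofReal_le_measure_isFeasible hmeas hconvex hinterior hunique xhat hxhat P (U n D)
          hDU (P₀ n D) hε hβ (hδpos n D) hD
      · rw [Set.indicator_of_notMem hDU]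
        exact zero_le
    have hp1 : (dataLaw P n).real {D | P ∈ U n D} ≤ 1 := measureReal_le_one
    have hp0 : 0 ≤ (dataLaw P n).real {D | P ∈ U n D} := measureReal_nonneg
    have h1 := ENNReal.toReal_mono ((hJ1 n).trans_lt ENNReal.one_lt_top).ne hlow
    rw [ENNReal.toReal_mul] at h1
    have h2 : 1 - β ≤ (ENNReal.ofReal (1 - β)).toReal := by
      rw [ENNReal.toReal_ofReal']
      exact le_max_left _ _
    have h3 := mul_le_mul_of_nonneg_right h2 hp0
    have h4 : (dataLaw P n {D | P ∈ U n D}).toReal = (dataLaw P n).real {D | P ∈ U n D} := rfl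
    rw [h4] at h1
    -- `(1 - β) p ≥ p - β` because `p ≤ 1`
    nlinarith
  have hcob : IsCoboundedUnder (· ≥ ·) atTop fun n : ℕ => (J n).toReal :=
    (isBoundedUnder_of ⟨1, fun n =>
      ENNReal.toReal_le_of_le_ofReal zero_le_one (by simpa using hJ1 n)⟩).isCoboundedUnder_ge
  have hbdd : IsBoundedUnder (· ≥ ·) atTop fun n : ℕ => (dataLaw P n).real {D | P ∈ U n D} :=
    isBoundedUnder_of ⟨0, fun n => measureReal_nonneg⟩
  refine le_of_forall_lt fun a ha => ?_
  obtain ⟨a', ha, ha'⟩ := exists_between ha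
  refine ha.trans_le (le_liminf_of_le hcob ?_)
  filter_upwards [eventually_lt_of_lt_liminf (show a' + β < _ by linarith [hcover]) hbdd] with n hn
  linarith [hle n]
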